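/- Fix a countably infinite universe $\mathbb U$. A \emph{database schema} $\tau$ is a finite, nonempty set of relation symbols $R$ with arities $\mathrm{ar}(R)\in\mathbb N$. A \emph{$\tau$-fact} is an expression $R(u_1,\dots,u_{\mathrm{ar}(R)})$ with $R\in\tau$ and $u_i\in\mathbb U$, and a \emph{$\tau$-instance} is a finite set of $\tau$-facts. A \emph{probabilistic database} (PDB) of schema $\tau$ is a discrete probability space $\mathcal D=(\mathbb D,P)$ whose (nonempty, countable) sample space $\mathbb D$ is a set of $\tau$-instances. Let $\mathrm{facts}(\mathcal D)$ be the set of all facts that belong to some instance of positive probability. A PDB $\mathcal I$ is \emph{tuple-independent} if for all $k\in\mathbb N$ and all pairwise distinct $f_1,\dots,f_k\in\mathrm{facts}(\mathcal I)$, $$\Pr_{I\sim\mathcal I}(f_1\in I,\dots,f_k\in I)=\prod_{i=1}^k\Pr_{I\sim\mathcal I}(f_i\in I).$$ It is \emph{block-independent disjoint} if there is a partition $\mathcal B$ of $\mathrm{facts}(\mathcal I)$ into blocks such that (1) the same equation holds for all $k\in\mathbb N$ and all $f_1,\dots,f_k$ from pairwise different blocks, and (2) $\Pr_{I\sim\mathcal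 I}(f\in I\text{ and }f'\in I)=0$ for all $f\neq f'$ in the same block. Let $\mathsf{TI}$ and $\mathsf{BID}$ be the classes of tuple-independent and of block-independent disjoint PDBs over $\mathbb U$ (of arbitrary schemas). An \emph{FO-view} $V$ from schema $\sigma$ to schema $\tau$ consists of a first-order formula $\Phi_R(x_1,\dots,x_{\mathrm{ar}(R)})$ over $\sigma$, with equality and with constants from $\mathbb U$, for every $R\in\tau$. Formulas are evaluated under active domain semantics: on a $\sigma$-instance $D$, the quantifiers and the free variables of $\Phi_R$ range over $\mathrm{adom}(D,\Phi_R)$, the set of all elements of $\mathbb U$ that occur in $D$ or as a constant in $\Phi_R$. The $\tau$-instance $V(D)$ consists of all facts $R(a_1,\dots,a_{\mathrm{ar}(R)})$ with $R\in\tau$, all $a_i\in\mathrm{adom}(D,\Phi_R)$ and $D\models\Phi_R[a_1,\dots,a_{\mathrm{ar}(R)}]$. If $\mathcal I=(\mathbb I,P)$ is a PDB of schema $\sigma$ and $\mathbb D$ is a set of $\tau$-instances with $V(\mathbb I)\subseteq\mathbb D$, the \emph{image} of $\mathcal I$ under $V:\mathbb I\to\mathbb D$ is the PDB $(\mathbb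 D,P')$ with $P'(\{D\})=P(\{I\in\mathbb I: V(I)=D\})$ for all $D\in\mathbb D$. For a class $\mathsf C$ of PDBs over $\mathbb U$, let $\mathsf{FO}(\mathsf C)$ be the class of all images of PDBs in $\mathsf C$ under FO-views. \textbf{Theorem.} Every block-independent disjoint PDB is the image of a tuple-independent PDB under an FO-view, that is, $\mathsf{BID}\subseteq\mathsf{FO}(\mathsf{TI})$. Consequently, $\mathsf{FO}(\mathsf{BID})=\mathsf{FO}(\mathsf{TI})$. -/

import Mathlib

open scoped ENNReal

noncomputable section

namespace ProbDB

universe u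

/-- A database schema: a finite, nonempty set of relation symbols with arities. -/
structure Schema where
  Rel : Type
  finite_rel : Finite Rel
  nonempty_rel : Nonempty Rel
  arity : Rel → ℕ

attribute [instance] Schema.finite_rel Schema.nonempty_rel

/-- A fact `R(u₁, …, u_r)` over the schema `τ` with entries in the universe `U`. -/
abbrev Fact (τ : Schema) (U : Type u) : Type u :=
  Σ R : τ.Rel, (Fin (τ.arity R) → U)

/-- A database instance: a finite set of facts. -/
abbrev Instance (τ : Schema) (U : Type u) : Type u := Finset (Fact τ U)

/-- The active domain of an instance. -/
def adom {τ : Schema} {U : Type u} (D : Instance τ U) : Set U :=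
  {a | ∃ f ∈ D, ∃ i, f.2 i = a}

theorem adom_finite {τ : Schema} {U : Type u} (D : Instance τ U) : (adom D).Finite := by
  have h : adom D = ⋃ f ∈ D, Set.range f.2 := by
    ext a
    simp [adom]
  rw [h]
  exact D.finite_toSet.biUnion fun f _ => Set.finite_range f.2

/-! ### First-order formulas -/

/-- Variables (out of `n` variables in scope) and constants from `U`. -/
inductive Term (U : Type u) (n : ℕ) : Type u
  | var (i : Fin n) : Term U n
  | const (a : U) : Term U n

/-- First-order formulas over `τ` with constants from `U` whose free variables are among the
`n` variables in scope. A quantifier binds variable `0` of the formula below it, and the variable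
`i` of the outer scope is the variable `i + 1` of the inner one. -/
inductive Formula (τ : Schema) (U : Type u) : ℕ → Type u
  | rel {n : ℕ} (R : τ.Rel) (t : Fin (τ.arity R) → Term U n) : Formula τ U n
  | eq {n : ℕ} (s t : Term U n) : Formula τ U n
  | neg {n : ℕ} (φ : Formula τ U n) : Formula τ U n
  | and {n : ℕ} (φ ψ : Formula τ U n) : Formula τ U n
  | or {n : ℕ} (φ ψ : Formula τ U n) : Formula τ U n
  | ex {n : ℕ} (φ : Formula τ U (n + 1)) : Formula τ U n
  | all {n : ℕ} (φ : Formula τ U (n + 1)) : Formula τ U n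

namespace Term

variable {U : Type u} {n : ℕ}

/-- The value of a term under a valuation. -/
def eval (v : Fin n → U) : Term U n → U
  | var i => v i
  | const a => a

/-- The constants occurring in a term. -/
def consts : Term U n → Set U
  | var _ => ∅
  | const a => {a}

theorem consts_finite (t : Term U n) : t.consts.Finite := by
  cases t <;> simp [consts]

end Term

namespace Formula

variable {τ : Schema} {U : Type u}

/-- The set of constants occurring in a formula. -/
def consts : {n : ℕ} → Formula τ U n → Set U
  | _, rel _ t => ⋃ i, (t i).consts
  | _, eq s t => s.consts ∪ t.consts
  | _, neg φ => φ.consts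
  | _, and φ ψ => φ.consts ∪ ψ.consts
  | _, or φ ψ => φ.consts ∪ ψ.consts
  | _, ex φ => φ.consts
  | _, all φ => φ.consts

theorem consts_finite {n : ℕ} (φ : Formula τ U n) : φ.consts.Finite := by
  induction φ with
  | rel R t => exact Set.finite_iUnion fun i => (t i).consts_finite
  | eq s t => exact s.consts_finite.union t.consts_finite
  | neg φ ih => exact ih
  | and φ ψ ih₁ ih₂ => exact ih₁.union ih₂
  | or φ ψ ih₁ ih₂ => exact ih₁.union ih₂
  | ex φ ih => exact ih
  | all φ ih => exact ih

/-- Truth of a formula in the instance `D` under the valuation `v`, with all quantifiers ranging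
over the set `A`. -/
def Holds (D : Instance τ U) (A : Set U) : {n : ℕ} → Formula τ U n → (Fin n → U) → Prop
  | _, rel R t, v => (⟨R, fun i => (t i).eval v⟩ : Fact τ U) ∈ D
  | _, eq s t, v => s.eval v = t.eval v
  | _, neg φ, v => ¬ φ.Holds D A v
  | _, and φ ψ, v => φ.Holds D A v ∧ ψ.Holds D A v
  | _, or φ ψ, v => φ.Holds D A v ∨ ψ.Holds D A v
  | _, ex φ, v => ∃ a ∈ A, φ.Holds D A (Fin.cons a v)
  | _, all φ, v => ∀ a ∈ A, φ.Holds D A (Fin.cons a v)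

/-- The domain of evaluation `adom(D, φ)`: the active domain of `D` and the constants of `φ`. -/
def activeDomain {n : ℕ} (φ : Formula τ U n) (D : Instance τ U) : Set U :=
  adom D ∪ φ.consts

/-- The answer to the query `φ` on `D` under active domain semantics, as a set of tuples. -/
def answers {n : ℕ} (φ : Formula τ U n) (D : Instance τ U) : Set (Fin n → U) :=
  {a | (∀ i, a i ∈ φ.activeDomain D) ∧ φ.Holds D (φ.activeDomain D) a}

theorem answers_finite {n : ℕ} (φ : Formula τ U n) (D : Instance τ U) :
    (φ.answers D).Finite := by
  have h : (φ.activeDomain D).Finite := (adom_finite D).union φ.consts_finite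
  exact (Set.Finite.pi' fun _ : Fin n => h).subset fun a ha => ha.1

end Formula

/-- An FO-view from schema `σ` to schema `τ`: one formula over `σ` for every relation symbol `R`
of `τ`, with as many (ordered) variables as the arity of `R`. -/
abbrev FOView (σ τ : Schema) (U : Type u) : Type u :=
  (R : τ.Rel) → Formula σ U (τ.arity R)

namespace FOView

variable {σ τ : Schema} {U : Type u}

theorem apply_finite (V : FOView σ τ U) (D : Instance σ U) :
    {f : Fact τ U | f.2 ∈ (V f.1).answers D}.Finite := by
  have h : {f : Fact τ U | f.2 ∈ (V f.1).answers D} =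
      ⋃ R : τ.Rel, (fun a => (⟨R, a⟩ : Fact τ U)) '' (V R).answers D := by
    ext ⟨R, a⟩
    simp only [Set.mem_ofPred_eq, Set.mem_iUnion, Set.mem_image]
    constructor
    · intro ha
      exact ⟨R, a, ha, rfl⟩
    · rintro ⟨R', a', ha', h⟩
      cases h
      exact ha'
  rw [h]
  exact Set.finite_iUnion fun R => ((V R).answers_finite D).image _

/-- The instance `V(D)`: it contains `R(a)` exactly if `a` is an answer on `D` to the formula of
`V` for `R`. -/
def apply (V : FOView σ τ U) (D : Instance σ U) : Instance τ U :=
  (V.apply_finite D).toFinset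

end FOView

/-! ### Probabilistic databases -/

/-- A probabilistic database over the universe `U` (which is countable wherever this is used, so
that there are only countably many instances): a set `space` of instances, the sample space, with
a discrete probability distribution on it, given here by its extension by zero to all instances. -/
structure PDB (τ : Schema) (U : Type u) where
  space : Set (Instance τ U)
  dist : PMF (Instance τ U)
  support_subset : dist.support ⊆ space

namespace PDB

variable {τ : Schema} {U : Type u}

/-- The probability of an event. -/
def prob (𝓓 : PDB τ U) (E : Set (Instance τ U)) : ℝ≥0∞ := 𝓓.dist.toOuterMeasure E

/-- The possible worlds: the instances of positive probability. -/
def worlds (𝓓 : PDB τ U) : Set (Instance τ U) := {D | 0 < 𝓓.dist D}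

/-- The facts appearing in possible worlds. -/
def facts (𝓓 : PDB τ U) : Set (Fact τ U) := {f | ∃ D ∈ 𝓓.worlds, f ∈ D}

/-- Tuple-independence: the events `f ∈ I`, for `f` a fact of the PDB, are independent. -/
def IsTupleIndependent (𝓘 : PDB τ U) : Prop :=
  ∀ (k : ℕ) (f : Fin k → Fact τ U), Function.Injective f → (∀ i, f i ∈ 𝓘.facts) →
    𝓘.prob {I | ∀ i, f i ∈ I} = ∏ i, 𝓘.prob {I | f i ∈ I}

/-- `𝓑` is a partition of the set `F`. -/
def IsPartitionOf {α : Type*} (𝓑 : Set (Set α)) (F : Set α) : Prop :=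
  ∅ ∉ 𝓑 ∧ 𝓑.PairwiseDisjoint id ∧ ⋃₀ 𝓑 = F

/-- Block-independent disjointness: the facts can be partitioned into blocks such that facts from
pairwise different blocks are independent and different facts of the same block are exclusive. -/
def IsBlockIndependentDisjoint (𝓘 : PDB τ U) : Prop :=
  ∃ 𝓑 : Set (Set (Fact τ U)), IsPartitionOf 𝓑 𝓘.facts ∧
    (∀ (k : ℕ) (B : Fin k → Set (Fact τ U)) (f : Fin k → Fact τ U), Function.Injective B →
      (∀ i, B i ∈ 𝓑) → (∀ i, f i ∈ B i) →
      𝓘.prob {I | ∀ i, f i ∈ I} = ∏ i, 𝓘.prob {I | f i ∈ I}) ∧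
    (∀ B ∈ 𝓑, ∀ f ∈ B, ∀ f' ∈ B, f ≠ f' → 𝓘.prob {I | f ∈ I ∧ f' ∈ I} = 0)

/-- `𝓓 = V(𝓘)`: the view `V` maps the sample space of `𝓘` to that of `𝓓`, and the distribution of
`𝓓` is the image under `V` of the distribution of `𝓘`. -/
def IsImage {σ : Schema} (V : FOView σ τ U) (𝓘 : PDB σ U) (𝓓 : PDB τ U) : Prop :=
  (∀ I ∈ 𝓘.space, V.apply I ∈ 𝓓.space) ∧
    ∀ D, 𝓓.dist D = 𝓘.prob {I | V.apply I = D}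

end PDB

/-- Classes of PDBs over the universe `U`, of arbitrary schemas. -/
abbrev PDBClass (U : Type u) : Type (max 1 u) := Set (Σ τ : Schema, PDB τ U)

/-- The class of tuple-independent PDBs. -/
def TI (U : Type u) : PDBClass U := {𝓘 | 𝓘.2.IsTupleIndependent}

/-- The class of block-independent disjoint PDBs. -/
def BID (U : Type u) : PDBClass U := {𝓘 | 𝓘.2.IsBlockIndependentDisjoint}

/-- The class of images of the PDBs in a class under FO-views. -/
def FO {U : Type u} (C : PDBClass U) : PDBClass U :=
  {𝓓 | ∃ 𝓘 ∈ C, ∃ V : FOView 𝓘.1 𝓓.1 U, PDB.IsImage V 𝓘.2 𝓓.2}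

end ProbDB

end

/-! Label every fact with an element of the universe coding its block. The isolated facts of an
instance, those alone with their label, form a first-order definable set that never contains two
facts of one block. So let the facts occur independently, with odds `w f`, and keep the isolated
ones: different blocks stay independent, and block `k` yields exactly `{f}` with probability `w f /
Z k`, where `Z k` is the total weight of the finite subsets of the block. The odds `w f = t k * p f`
produce the prescribed marginal `p f` as soon as `Z k = t k`. If the marginals sum to at most 1/4,
this equation has a solution `t k ≤ 2`, a least fixed point, and the resulting weights can be
normalised (`exists_odds`, `exists_indepFacts_isolated`).

In general the marginals have a finite sum, by a second moment argument
(`BlockIndep.tsum_marginal_ne_top`), so all but finitely many facts have total marginal at most 1/4.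
Each exceptional fact `s` is deleted and put back by an independent coin, a new nullary fact, whose
bias is the probability of `s` given that no other fact of its block is present
(`BlockIndep.exists_coin`). Putting it back is definable with the entries of `s` as constants.

The constructions are maps on instances, handled as `DefinableMap`: closed under composition and
always given by an FO-view (`DefinableMap.exists_view`). Closure also turns a view of a
block-independent disjoint PDB into a view of a tuple-independent one; the converse inclusion uses
singleton blocks. -/

noncomputable section

namespace ProbDB

universe u

variable {σ τ : Schema} {U : Type u}

/-! ### Domain-independent first-order definability -/

namespace Term

/-- Weakening of a term by one new variable `0`. -/
def shift {n : ℕ} : Term U n → Term U (n + 1)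
  | var i => var i.succ
  | const a => const a

theorem eval_shift {n : ℕ} (t : Term U n) (a : U) (v : Fin n → U) :
    t.shift.eval (Fin.cons a v) = t.eval v := by
  cases t <;> simp [shift, eval]

/-- Substitution of terms for the variables of a term. -/
def bind {m n : ℕ} (t : Fin m → Term U n) : Term U m → Term U n
  | var i => t i
  | const a => const a

theorem eval_bind {m n : ℕ} (t : Fin m → Term U n) (s : Term U m) (v : Fin n → U) :
    (s.bind t).eval v = s.eval fun i => (t i).eval v := by
  cases s <;> simp [bind, eval]

end Term

/-- A query is definable if all its instances under substitution of terms are expressed by formulas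
whose truth does not depend on the domain of evaluation, as long as this is large enough. -/
def DefinableQuery {ι : Type} (P : Instance σ U → (ι → U) → Prop) : Prop :=
  ∀ (n : ℕ) (t : ι → Term U n), ∃ (φ : Formula σ U n) (C : Set U), C.Finite ∧
    ∀ (D : Instance σ U) (A : Set U), adom D ∪ C ⊆ A → ∀ v : Fin n → U,
      φ.Holds D A v ↔ P D fun i => (t i).eval v

namespace DefinableQuery

variable {ι κ : Type} {P Q : Instance σ U → (ι → U) → Prop}

theorem congr (hP : DefinableQuery P) (h : ∀ D v, P D v ↔ Q D v) : DefinableQuery Q := by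
  have : P = Q := by
    funext D v
    exact propext (h D v)
  exact this ▸ hP

theorem comp (hP : DefinableQuery P) (g : ι → κ) :
    DefinableQuery fun (D : Instance σ U) (v : κ → U) => P D fun i => v (g i) :=
  fun n t => hP n fun i => t (g i)

theorem substTerm {m : ℕ} (hP : DefinableQuery P) (s : ι → Term U m) :
    DefinableQuery fun (D : Instance σ U) (v : Fin m → U) => P D fun i => (s i).eval v := by
  intro n t
  obtain ⟨φ, C, hC, h⟩ := hP n fun i => (s i).bind t
  refine ⟨φ, C, hC, fun D A hA v => ?_⟩
  rw [h D A hA v]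
  simp only [Term.eval_bind]

theorem mem (R : σ.Rel) (g : Fin (σ.arity R) → ι) :
    DefinableQuery fun (D : Instance σ U) v => (⟨R, fun i => v (g i)⟩ : Fact σ U) ∈ D :=
  fun _ t => ⟨.rel R fun i => t (g i), ∅, Set.finite_empty, fun _ _ _ _ => Iff.rfl⟩

theorem eqVar (i j : ι) : DefinableQuery fun (_ : Instance σ U) v => v i = v j :=
  fun _ t => ⟨.eq (t i) (t j), ∅, Set.finite_empty, fun _ _ _ _ => Iff.rfl⟩

theorem eqConst (i : ι) (c : U) : DefinableQuery fun (_ : Instance σ U) v => v i = c :=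
  fun _ t => ⟨.eq (t i) (.const c), ∅, Set.finite_empty, fun _ _ _ _ => Iff.rfl⟩

theorem not (hP : DefinableQuery P) : DefinableQuery fun D v => ¬ P D v := by
  intro n t
  obtain ⟨φ, C, hC, h⟩ := hP n t
  exact ⟨.neg φ, C, hC, fun D A hA v => not_congr (h D A hA v)⟩

theorem and (hP : DefinableQuery P) (hQ : DefinableQuery Q) :
    DefinableQuery fun D v => P D v ∧ Q D v := by
  intro n t
  obtain ⟨φ, C, hC, h⟩ := hP n t
  obtain ⟨ψ, C', hC', h'⟩ := hQ n t
  refine ⟨.and φ ψ, C ∪ C', hC.union hC', fun D A hA v => and_congr (h D A ?_ v) (h' D A ?_ v)⟩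
  · exact (Set.union_subset_union_right _ Set.subset_union_left).trans hA
  · exact (Set.union_subset_union_right _ Set.subset_union_right).trans hA

theorem or (hP : DefinableQuery P) (hQ : DefinableQuery Q) :
    DefinableQuery fun D v => P D v ∨ Q D v :=
  (hP.not.and hQ.not).not.congr fun D v => by tauto

/-- Every witness lies in `adom D ∪ C`, so quantifying over `U` and over any large enough domain of
evaluation is the same. -/
theorem ex {P : Instance σ U → (Option ι → U) → Prop} (hP : DefinableQuery P) {C : Set U}
    (hC : C.Finite) (hb : ∀ D v, P D v → v none ∈ adom D ∪ C) :
    DefinableQuery fun D (v : ι → U) => ∃ a, P D fun o => o.elim a v := by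
  intro n t
  obtain ⟨φ, C', hC', h⟩ := hP (n + 1) fun o => o.elim (.var 0) fun i => (t i).shift
  refine ⟨.ex φ, C ∪ C', hC.union hC', fun D A hA v => ?_⟩
  have key : ∀ a, φ.Holds D A (Fin.cons a v) ↔ P D fun o => o.elim a fun i => (t i).eval v := by
    intro a
    rw [h D A ((Set.union_subset_union_right _ Set.subset_union_right).trans hA)]
    apply iff_of_eq
    congr 1
    funext o
    cases o
    · rfl
    · exact Term.eval_shift _ _ _
  constructor
  · rintro ⟨a, -, ha⟩
    exact ⟨a, (key a).1 ha⟩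
  · rintro ⟨a, ha⟩
    exact ⟨a, hA (Set.union_subset_union_right _ Set.subset_union_left (hb _ _ ha)), (key a).2 ha⟩

theorem exTuple {k : ℕ} {P : Instance σ U → (Fin k ⊕ ι → U) → Prop} (hP : DefinableQuery P)
    {C : Set U} (hC : C.Finite) (hb : ∀ D v, P D v → ∀ i, v (.inl i) ∈ adom D ∪ C) :
    DefinableQuery fun D (v : ι → U) => ∃ y : Fin k → U, P D (Sum.elim y v) := by
  induction k generalizing ι with
  | zero =>
    refine (hP.comp (Sum.elim Fin.elim0 id)).congr fun D v => ?_
    have : ∀ y : Fin 0 → U, (fun i => v (Sum.elim Fin.elim0 id i)) = Sum.elim y v := by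
      intro y
      funext i
      rcases i with i | i
      · exact i.elim0
      · rfl
    constructor
    · intro h
      exact ⟨Fin.elim0, this Fin.elim0 ▸ h⟩
    · rintro ⟨y, h⟩
      rw [this y]
      exact h
  | succ k ih =>
    -- The first coordinate of the tuple becomes the variable `none`, quantified by `ex` after the
    -- others.
    let g : Fin (k + 1) ⊕ ι → Fin k ⊕ Option ι :=
      Sum.elim (Fin.cases (.inr none) fun i => .inl i) fun i => .inr (some i)
    have hg : ∀ a (y : Fin k → U) (v : ι → U),
        (fun i => (Sum.elim y fun o : Option ι => o.elim a v) (g i)) =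
          Sum.elim (Fin.cons a y : Fin (k + 1) → U) v := by
      intro a y v
      funext i
      rcases i with i | i
      · refine Fin.cases ?_ (fun i => ?_) i <;> rfl
      · rfl
    have h1 := ih (hP.comp g) fun D v h i => hb D _ h i.succ
    refine (h1.ex hC ?_).congr fun D v => ?_
    · rintro D v ⟨y, h⟩
      exact hb D _ h 0
    · constructor
      · rintro ⟨a, y, h⟩
        rw [hg] at h
        exact ⟨_, h⟩
      · rintro ⟨y, h⟩
        refine ⟨y 0, Fin.tail y, ?_⟩
        rw [hg, Fin.cons_self_tail]
        exact h

/-- The syntax has no falsum; `∃ x, x ≠ x` is false over every domain, the empty one included. -/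
theorem false : DefinableQuery fun (_ : Instance σ U) (_ : ι → U) => False := fun _ _ =>
  ⟨.ex (.neg (.eq (.var 0) (.var 0))), ∅, Set.finite_empty, fun _ _ _ _ =>
    ⟨fun ⟨_, _, h⟩ => h rfl, False.elim⟩⟩

theorem existsFinite {γ : Type} [Finite γ] {P : γ → Instance σ U → (ι → U) → Prop}
    (hP : ∀ x, DefinableQuery (P x)) : DefinableQuery fun D v => ∃ x, P x D v := by
  classical
  have := Fintype.ofFinite γ
  have key : ∀ s : Finset γ, DefinableQuery fun D v => ∃ x ∈ s, P x D v := by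
    intro s
    induction s using Finset.induction_on with
    | empty => exact false.congr fun D v => by simp
    | insert x s _ ih => exact ((hP x).or ih).congr fun D v => by simp
  exact (key Finset.univ).congr fun D v => by simp

theorem forallFinite {γ : Type} [Finite γ] {P : γ → Instance σ U → (ι → U) → Prop}
    (hP : ∀ x, DefinableQuery (P x)) : DefinableQuery fun D v => ∀ x, P x D v :=
  (existsFinite fun x => (hP x).not).not.congr fun D v => by push Not; rfl

theorem const (p : Prop) : DefinableQuery fun (_ : Instance σ U) (_ : ι → U) => p := by
  by_cases h : p
  · exact false.not.congr fun D v => by simp [h]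
  · exact false.congr fun D v => by simp [h]

theorem memFinite {C : Set U} (hC : C.Finite) (i : ι) :
    DefinableQuery fun (_ : Instance σ U) v => v i ∈ C := by
  induction C, hC using Set.Finite.induction_on with
  | empty => exact false.congr fun D v => by simp
  | @insert a s _ hs ih =>
    exact ((eqConst i a).or ih).congr fun D v => by simp

end DefinableQuery

/-- A transformation of instances is definable if all its relations are, and it introduces only
finitely many new elements. -/
structure DefinableMap (T : Instance σ U → Instance τ U) : Prop where
  mem : ∀ R, DefinableQuery fun D (v : Fin (τ.arity R) → U) => (⟨R, v⟩ : Fact τ U) ∈ T D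
  bound : ∃ C : Set U, C.Finite ∧ ∀ D, adom (T D) ⊆ adom D ∪ C

namespace DefinableMap

variable {ι : Type} {T : Instance σ U → Instance τ U}

protected theorem id : DefinableMap (id : Instance σ U → Instance σ U) where
  mem R := DefinableQuery.mem R id
  bound := ⟨∅, Set.finite_empty, fun _ => Set.subset_union_left⟩

/-- A finite disjunction over the relation symbols, then a tuple quantifier that is bounded because
`T` adds only finitely many elements. -/
theorem existsFact (hT : DefinableMap T) {P : Fact τ U → Instance σ U → (ι → U) → Prop}
    (hP : ∀ R, DefinableQuery fun D (v : Fin (τ.arity R) ⊕ ι → U) =>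
      P ⟨R, fun i => v (.inl i)⟩ D fun i => v (.inr i)) :
    DefinableQuery fun D v => ∃ f ∈ T D, P f D v := by
  obtain ⟨C, hC, hb⟩ := hT.bound
  have key : ∀ R, DefinableQuery fun D (v : ι → U) =>
      ∃ y : Fin (τ.arity R) → U, (⟨R, y⟩ : Fact τ U) ∈ T D ∧ P ⟨R, y⟩ D v := fun R =>
    (((hT.mem R).comp Sum.inl).and (hP R)).exTuple hC fun D v h i => hb D ⟨_, h.1, i, rfl⟩
  refine (DefinableQuery.existsFinite key).congr fun D v => ?_
  constructor
  · rintro ⟨R, y, h, h'⟩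
    exact ⟨_, h, h'⟩
  · rintro ⟨⟨R, y⟩, h, h'⟩
    exact ⟨R, y, h, h'⟩

theorem memAdom (hT : DefinableMap T) (i : ι) : DefinableQuery fun D v => v i ∈ adom (T D) :=
  hT.existsFact (P := fun f _ v => ∃ j, f.2 j = v i) fun R =>
    DefinableQuery.existsFinite fun j : Fin (τ.arity R) => .eqVar (Sum.inl j) (Sum.inr i)

/-- The usual interpretation argument: atoms are replaced by their definitions in `D`, and
quantifiers are relativised to `adom (T D) ∪ K`, which is itself definable. -/
theorem holds (hT : DefinableMap T) {K : Set U} (hK : K.Finite) {n : ℕ} (φ : Formula τ U n) :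
    DefinableQuery fun D v => φ.Holds (T D) (adom (T D) ∪ K) v := by
  have hguard : ∀ {κ : Type} (i : κ), DefinableQuery fun D v => v i ∈ adom (T D) ∪ K := fun i =>
    (hT.memAdom i).or (.memFinite hK i)
  obtain ⟨C, hC, hb⟩ := hT.bound
  have hex : ∀ {n : ℕ} {φ : Formula τ U (n + 1)},
      (DefinableQuery fun D v => φ.Holds (T D) (adom (T D) ∪ K) v) →
      DefinableQuery fun D (v : Fin n → U) =>
        ∃ a ∈ adom (T D) ∪ K, φ.Holds (T D) (adom (T D) ∪ K) (Fin.cons a v) := by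
    intro n φ h
    refine (((hguard (none : Option (Fin n))).and (h.comp (Fin.cases none some))).ex
      (hC.union hK) ?_).congr fun D v => ?_
    · rintro D v ⟨h | h, -⟩
      · exact (hb D h).imp id Or.inl
      · exact Or.inr (Or.inr h)
    · refine exists_congr fun a => and_congr Iff.rfl (iff_of_eq ?_)
      congr 1
      funext i
      refine Fin.cases ?_ (fun i => ?_) i <;> rfl
  induction φ with
  | rel R t => exact (hT.mem R).substTerm t
  | eq s t =>
    exact (DefinableQuery.eqVar (0 : Fin 2) 1).substTerm (fun i => if i = 0 then s else t)
  | neg φ ih => exact ih.not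
  | and φ ψ ih ih' => exact ih.and ih'
  | or φ ψ ih ih' => exact ih.or ih'
  | ex φ ih => exact hex ih
  | all φ ih =>
    -- The universal quantifier is treated as `¬ ∃ ¬`.
    exact (hex (φ := .neg φ) ih.not).not.congr fun D v => by simp [Formula.Holds]

theorem apply_comp (hT : DefinableMap T) {ρ : Schema} (V : FOView τ ρ U) :
    DefinableMap fun D => V.apply (T D) := by
  have hmem : ∀ (R : ρ.Rel) D (v : Fin (ρ.arity R) → U),
      (⟨R, v⟩ : Fact ρ U) ∈ V.apply (T D) ↔ v ∈ (V R).answers (T D) := by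
    simp [FOView.apply]
  obtain ⟨C, hC, hb⟩ := hT.bound
  constructor
  · intro R
    simp only [hmem]
    refine DefinableQuery.and (.forallFinite fun i => ?_) (hT.holds (V R).consts_finite _)
    exact (hT.memAdom i).or (.memFinite (V R).consts_finite i)
  · refine ⟨C ∪ ⋃ R, (V R).consts,
      hC.union (Set.finite_iUnion fun R => (V R).consts_finite), fun D a => ?_⟩
    rintro ⟨⟨R, v⟩, hv, i, rfl⟩
    rw [hmem] at hv
    rcases hv.1 i with h | h
    · exact (hb D h).imp id Or.inl
    · exact Or.inr (Or.inr (Set.mem_iUnion.2 ⟨R, h⟩))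

/-- Conjoining trivial equations `c = c` enlarges the active domain of a formula without changing
its meaning over a fixed domain. -/
theorem exists_formula_consts {n : ℕ} (φ : Formula σ U n) {C : Set U} (hC : C.Finite) :
    ∃ ψ : Formula σ U n, C ⊆ ψ.consts ∧ ∀ D A v, ψ.Holds D A v ↔ φ.Holds D A v := by
  induction C, hC using Set.Finite.induction_on with
  | empty => exact ⟨φ, Set.empty_subset _, fun _ _ _ => Iff.rfl⟩
  | @insert a s _ hs ih =>
    obtain ⟨ψ, h, h'⟩ := ih
    refine ⟨.and (.eq (.const a) (.const a)) ψ, ?_, fun D A v => by simp [Formula.Holds, h']⟩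
    simp only [Formula.consts, Term.consts, Set.union_self]
    exact Set.insert_subset (Or.inl rfl) (h.trans Set.subset_union_right)

theorem exists_view (hT : DefinableMap T) : ∃ V : FOView σ τ U, ∀ D, V.apply D = T D := by
  obtain ⟨C, hC, hb⟩ := hT.bound
  have key : ∀ R, ∃ φ : Formula σ U (τ.arity R), ∀ D v,
      v ∈ φ.answers D ↔ (⟨R, v⟩ : Fact τ U) ∈ T D := by
    intro R
    obtain ⟨φ, C', hC', h⟩ := hT.mem R _ Term.var
    -- The constants in `C'` make the domain large enough for `φ`; those in `C` let the free
    -- variables reach every element that `T` may introduce.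
    obtain ⟨ψ, hψ, hψφ⟩ := exists_formula_consts φ (hC.union hC')
    refine ⟨ψ, fun D v => ?_⟩
    have hA : adom D ∪ C' ⊆ ψ.activeDomain D :=
      Set.union_subset_union_right _ (Set.subset_union_right.trans hψ)
    have hv := h D _ hA v
    rw [← hψφ] at hv
    refine ⟨fun hv' => hv.1 hv'.2, fun hv' => ⟨fun i => ?_, hv.2 hv'⟩⟩
    exact (hb D ⟨_, hv', i, rfl⟩).imp id fun h => hψ (Or.inl h)
  choose V hV using key
  refine ⟨V, fun D => ?_⟩
  ext ⟨R, v⟩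
  simp [FOView.apply, hV]

theorem comp {ρ : Schema} {S : Instance τ U → Instance ρ U} (hS : DefinableMap S)
    (hT : DefinableMap T) : DefinableMap fun D => S (T D) := by
  obtain ⟨V, hV⟩ := hS.exists_view
  simpa only [hV] using hT.apply_comp V

end DefinableMap

end ProbDB
end

noncomputable section

namespace ProbDB

/-! ### Discrete probability -/

theorem pmf_inter_add_diff {β : Type*} (μ : PMF β) (E N : Set β) :
    μ.toOuterMeasure (E ∩ N) + μ.toOuterMeasure (E \ N) = μ.toOuterMeasure E := by
  let _ : MeasurableSpace β := ⊤
  simp only [← PMF.toMeasure_apply_eq_toOuterMeasure]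
  exact MeasureTheory.measure_inter_add_sdiff _ trivial

theorem pmf_univ {β : Type*} (μ : PMF β) : μ.toOuterMeasure Set.univ = 1 :=
  (μ.toOuterMeasure_apply_eq_one_iff _).2 (Set.subset_univ _)

theorem pmf_le_one {β : Type*} (μ : PMF β) (E : Set β) : μ.toOuterMeasure E ≤ 1 :=
  (pmf_univ μ) ▸ μ.toOuterMeasure.mono (Set.subset_univ E)

theorem pmf_ne_top {β : Type*} (μ : PMF β) (E : Set β) : μ.toOuterMeasure E ≠ ∞ :=
  ((pmf_le_one μ E).trans_lt ENNReal.one_lt_top).ne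

theorem pmf_iUnion {β ι : Type*} [Countable ι] (μ : PMF β) (E : ι → Set β)
    (h : ∀ i j, i ≠ j → μ.toOuterMeasure (E i ∩ E j) = 0) :
    μ.toOuterMeasure (⋃ i, E i) = ∑' i, μ.toOuterMeasure (E i) := by
  let _ : MeasurableSpace β := ⊤
  simp only [← PMF.toMeasure_apply_eq_toOuterMeasure] at h ⊢
  refine MeasureTheory.measure_iUnion₀ (fun i j hij => h i j hij) fun i => ?_
  exact MeasurableSet.nullMeasurableSet trivial

variable {α κ : Type*}

/-- Distributions of finite random sets are determined by the inclusion probabilities of finite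
sets. -/
theorem pmf_finset_ext [Countable α] {μ ν : PMF (Finset α)}
    (h : ∀ F : Finset α, μ.toOuterMeasure {D | F ⊆ D} = ν.toOuterMeasure {D | F ⊆ D}) :
    μ = ν := by
  classical
  let _ : MeasurableSpace (Finset α) := ⊤
  apply PMF.toMeasure_injective
  refine MeasureTheory.ext_of_generate_finite
    (Set.range fun F : Finset α => {D : Finset α | F ⊆ D}) ?_ ?_ ?_ ?_
  · refine le_antisymm ?_ le_top
    have hgen : ∀ F : Finset α, @MeasurableSet _ (MeasurableSpace.generateFrom
        (Set.range fun F : Finset α => {D : Finset α | F ⊆ D})) {D : Finset α | F ⊆ D} :=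
      fun F => MeasurableSpace.measurableSet_generateFrom (Set.mem_range_self F)
    intro s _
    rw [← Set.biUnion_of_singleton s]
    refine MeasurableSet.biUnion (Set.to_countable _) fun D _ => ?_
    -- Singletons are obtained from the inclusion events by a countable difference, so these events,
    -- a π-system since intersections correspond to unions of sets, generate everything.
    have : ({D} : Set (Finset α)) =
        {D' | D ⊆ D'} \ ⋃ f : {f // f ∉ D}, {D' | {f.1} ⊆ D'} := by
      ext D'
      simp only [Set.mem_singleton_iff, Set.mem_sdiff, Set.mem_ofPred_eq, Set.mem_iUnion,
        Finset.singleton_subset_iff, not_exists, Subtype.forall]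
      constructor
      · rintro rfl
        exact ⟨subset_rfl, fun _ h => h⟩
      · rintro ⟨h1, h2⟩
        exact Finset.Subset.antisymm (fun f hf => by_contra fun hf' => h2 f hf' hf) h1
    rw [this]
    exact (hgen D).diff (MeasurableSet.iUnion fun f => hgen {f.1})
  · rintro _ ⟨F, rfl⟩ _ ⟨F', rfl⟩ _
    refine ⟨F ∪ F', ?_⟩
    ext D
    simp [Finset.union_subset_iff]
  · rintro _ ⟨F, rfl⟩
    simp only [PMF.toMeasure_apply_eq_toOuterMeasure]
    exact h F
  · simp only [PMF.toMeasure_apply_eq_toOuterMeasure, pmf_univ]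

/-- The probability that the random finite set contains `f`. -/
def marginal (μ : PMF (Finset α)) (f : α) : ℝ≥0∞ := μ.toOuterMeasure {D | f ∈ D}

/-- Independence of the events `f ∈ D`. -/
def IndepFacts (μ : PMF (Finset α)) : Prop :=
  ∀ F : Finset α, μ.toOuterMeasure {D | F ⊆ D} = ∏ f ∈ F, marginal μ f

/-- Block-independent disjointness for the blocks given by the fibres of `lab`. -/
structure BlockIndep (lab : α → κ) (μ : PMF (Finset α)) : Prop where
  prod : ∀ F : Finset α, Set.InjOn lab F →
    μ.toOuterMeasure {D | F ⊆ D} = ∏ f ∈ F, marginal μ f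
  disj : ∀ f f', f ≠ f' → lab f = lab f' → μ.toOuterMeasure {D | f ∈ D ∧ f' ∈ D} = 0

theorem BlockIndep.eq_zero_of_not_injOn {lab : α → κ} {μ : PMF (Finset α)}
    (h : BlockIndep lab μ) {F : Finset α} (hF : ¬ Set.InjOn lab F) :
    μ.toOuterMeasure {D | F ⊆ D} = 0 := by
  simp only [Set.InjOn, not_forall] at hF
  obtain ⟨f, hf, f', hf', hl, hne⟩ := hF
  exact MeasureTheory.measure_mono_null
    (show {D | F ⊆ D} ⊆ {D | f ∈ D ∧ f' ∈ D} from fun D hD => ⟨hD hf, hD hf'⟩) (h.disj f f' hne hl)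

/-! ### Summability of the marginals -/

theorem tsum_indicator_eq_marginal (μ : PMF (Finset α)) [DecidableEq α] (f : α) :
    ∑' D, μ D * (if f ∈ D then 1 else 0) = marginal μ f := by
  rw [marginal, PMF.toOuterMeasure_apply]
  refine tsum_congr fun D => ?_
  by_cases h : f ∈ D <;> simp [h]

theorem tsum_indicator_pair (μ : PMF (Finset α)) [DecidableEq α] (f g : α) :
    ∑' D, μ D * ((if f ∈ D then 1 else 0) * (if g ∈ D then 1 else 0)) =
      μ.toOuterMeasure {D | f ∈ D ∧ g ∈ D} := by
  rw [PMF.toOuterMeasure_apply]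
  refine tsum_congr fun D => ?_
  by_cases h : f ∈ D <;> by_cases h' : g ∈ D <;> simp [h, h']

/-- This is `(n - m)² ≥ m² · [n = 0]`, rearranged to avoid truncated subtraction. -/
theorem sq_deviation_bound (m : ℝ≥0∞) (n : ℕ) :
    2 * m * n + m ^ 2 * (if n = 0 then 1 else 0) ≤ (n : ℝ≥0∞) ^ 2 + m ^ 2 := by
  by_cases hn : n = 0
  · simp [hn]
  · simp only [hn, if_false, mul_zero, add_zero]
    by_cases hm : m = ∞
    · simp [hm]
    · lift m to NNReal using hm
      have := two_mul_le_add_sq (m : ℝ) n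
      have h : 2 * m * n ≤ (n : NNReal) ^ 2 + m ^ 2 := by
        rw [← NNReal.coe_le_coe]
        push_cast
        linarith
      exact_mod_cast h

theorem BlockIndep.pair_le {lab : α → κ} {μ : PMF (Finset α)} (h : BlockIndep lab μ) {f g : α}
    (hfg : f ≠ g) : μ.toOuterMeasure {D | f ∈ D ∧ g ∈ D} ≤ marginal μ f * marginal μ g := by
  classical
  by_cases hl : lab f = lab g
  · rw [h.disj f g hfg hl]
    exact zero_le
  · have := h.prod {f, g} (by
      intro x hx y hy hxy
      simp only [Finset.coe_insert, Finset.coe_singleton, Set.mem_insert_iff,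
        Set.mem_singleton_iff] at hx hy
      rcases hx with rfl | rfl <;> rcases hy with rfl | rfl <;> simp_all)
    rw [Finset.prod_pair hfg] at this
    rw [← this]
    refine μ.toOuterMeasure.mono fun D hD => ?_
    simp only [Set.mem_ofPred_eq, Finset.insert_subset_iff, Finset.singleton_subset_iff]
    exact hD

/-- Chebyshev's argument. The number `N` of elements of `F` that are present has mean `m`, and
variance at most `m` since distinct facts are never positively correlated. As `N = 0` at `D₀`, `m² *
μ D₀ ≤ m`. -/
theorem BlockIndep.sum_marginal_mul_le {lab : α → κ} {μ : PMF (Finset α)} (h : BlockIndep lab μ)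
    {F D₀ : Finset α} (hF : Disjoint F D₀) : (∑ f ∈ F, marginal μ f) * μ D₀ ≤ 1 := by
  classical
  set m := ∑ f ∈ F, marginal μ f with hm
  have hmtop : m ≠ ∞ := ENNReal.sum_ne_top.2 fun f _ => pmf_ne_top _ _
  let i : α → Finset α → ℝ≥0∞ := fun f D => if f ∈ D then 1 else 0
  have hN : ∀ D, ((F ∩ D).card : ℝ≥0∞) = ∑ f ∈ F, i f D := by
    intro D
    simp only [i, Finset.sum_boole, Finset.filter_mem_eq_inter]
  have h1 : ∑' D, μ D * ((F ∩ D).card : ℝ≥0∞) = m := by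
    simp only [hN, Finset.mul_sum]
    rw [Summable.tsum_finsetSum fun _ _ => ENNReal.summable]
    exact Finset.sum_congr rfl fun f _ => tsum_indicator_eq_marginal μ f
  have h2 : ∑' D, μ D * ((F ∩ D).card : ℝ≥0∞) ^ 2 ≤ m + m ^ 2 := by
    simp only [hN, sq, Finset.sum_mul_sum]
    simp only [Finset.mul_sum]
    rw [Summable.tsum_finsetSum fun _ _ => ENNReal.summable]
    have : ∀ f ∈ F, ∑' D, ∑ g ∈ F, μ D * (i f D * i g D) ≤
        marginal μ f + ∑ g ∈ F, marginal μ f * marginal μ g := by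
      intro f hf
      rw [Summable.tsum_finsetSum fun _ _ => ENNReal.summable]
      rw [← Finset.add_sum_erase _ _ hf]
      refine add_le_add ?_ ?_
      · rw [tsum_indicator_pair, marginal]
        simp
      · refine (Finset.sum_le_sum fun g hg => ?_).trans
          (Finset.sum_le_sum_of_subset (Finset.erase_subset f F))
        rw [tsum_indicator_pair]
        exact h.pair_le (Finset.ne_of_mem_erase hg).symm
    refine (Finset.sum_le_sum this).trans_eq ?_
    rw [Finset.sum_add_distrib, hm, Finset.sum_mul_sum]
  have h3 : μ D₀ ≤ ∑' D, μ D * (if (F ∩ D).card = 0 then 1 else 0) := by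
    refine le_trans ?_ (ENNReal.le_tsum D₀)
    simp [Finset.disjoint_iff_inter_eq_empty.1 hF]
  have h4 : 2 * m * m + m ^ 2 * μ D₀ ≤ (m + m ^ 2) + m ^ 2 := by
    calc 2 * m * m + m ^ 2 * μ D₀
        ≤ 2 * m * (∑' D, μ D * ((F ∩ D).card : ℝ≥0∞)) +
          m ^ 2 * ∑' D, μ D * (if (F ∩ D).card = 0 then 1 else 0) := by
          rw [h1]
          gcongr
      _ = ∑' D, μ D * (2 * m * ((F ∩ D).card : ℝ≥0∞) +
          m ^ 2 * (if (F ∩ D).card = 0 then 1 else 0)) := by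
          rw [← ENNReal.tsum_mul_left, ← ENNReal.tsum_mul_left, ← ENNReal.tsum_add]
          refine tsum_congr fun D => ?_
          ring
      _ ≤ ∑' D, μ D * (((F ∩ D).card : ℝ≥0∞) ^ 2 + m ^ 2) := by
          exact ENNReal.tsum_le_tsum fun D => mul_le_mul_right (sq_deviation_bound _ _) _
      _ = (∑' D, μ D * ((F ∩ D).card : ℝ≥0∞) ^ 2) + m ^ 2 := by
          simp only [mul_add]
          rw [ENNReal.tsum_add, ENNReal.tsum_mul_right, PMF.tsum_coe, one_mul]
      _ ≤ _ := by gcongr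
  have hε : μ D₀ ≠ ∞ := PMF.apply_ne_top _ _
  generalize μ D₀ = ε at h4 hε
  clear_value m
  lift m to NNReal using hmtop
  lift ε to NNReal using hε
  norm_cast at h4 ⊢
  rw [← NNReal.coe_le_coe] at h4 ⊢
  push_cast at h4 ⊢
  by_contra hlt
  push Not at hlt
  have hm0 : 0 < (m : ℝ) := by
    rcases m.2.lt_or_eq with h0 | h0
    · exact h0
    · exact absurd hlt (by rw [show (m : ℝ) = 0 from h0.symm]; norm_num)
  nlinarith

/-- Fix any possible world `D₀`: facts outside it have total marginal at most `1 / μ D₀`, and only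
finitely many lie in it. -/
theorem BlockIndep.tsum_marginal_ne_top {lab : α → κ} {μ : PMF (Finset α)}
    (h : BlockIndep lab μ) : ∑' f, marginal μ f ≠ ∞ := by
  classical
  obtain ⟨D₀, hD₀⟩ := μ.support_nonempty
  rw [PMF.mem_support_iff] at hD₀
  have hle : ∀ F : Finset α,
      ∑ f ∈ F, marginal μ f ≤ ∑ f ∈ D₀, marginal μ f + (μ D₀)⁻¹ := by
    intro F
    rw [← Finset.sum_inter_add_sum_sdiff F D₀]
    refine add_le_add (Finset.sum_le_sum_of_subset Finset.inter_subset_right) ?_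
    rw [← one_div, ENNReal.le_div_iff_mul_le (Or.inl hD₀) (Or.inl (PMF.apply_ne_top _ _))]
    exact h.sum_marginal_mul_le Finset.sdiff_disjoint
  refine ne_top_of_le_ne_top ?_ (ENNReal.tsum_eq_iSup_sum.trans_le (iSup_le hle))
  exact ENNReal.add_ne_top.2 ⟨ENNReal.sum_ne_top.2 fun f _ => pmf_ne_top _ _,
    ENNReal.inv_ne_top.2 hD₀⟩

end ProbDB
end

noncomputable section

namespace ProbDB

variable {α κ : Type*}

/-! ### Independent facts from weights -/

/-- The weight of an event under the measure giving the finite set `D` the weight `∏ f ∈ D, w f`. -/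
def weight (w : α → ℝ≥0∞) (E : Set (Finset α)) : ℝ≥0∞ :=
  ∑' D, E.indicator (fun D => ∏ f ∈ D, w f) D

open scoped Classical in
-- `D ↦ (D ∩ A, D \ A)` is a bijection onto pairs of finite subsets of `A` and of `Aᶜ`, and the
-- product weight factors along it.
theorem weight_split (w : α → ℝ≥0∞) (A : Set α) (E E' : Set (Finset α)) :
    weight w {D | D.filter (· ∈ A) ∈ E ∧ D.filter (· ∉ A) ∈ E'} =
      weight w {D | ↑D ⊆ A ∧ D ∈ E} * weight w {D | ↑D ⊆ Aᶜ ∧ D ∈ E'} := by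
  let e : Finset α → Finset α × Finset α := fun D => (D.filter (· ∈ A), D.filter (· ∉ A))
  have he : Function.Injective e := by
    intro D D' h
    simp only [e, Prod.mk.injEq] at h
    rw [← Finset.filter_union_filter_not_eq (· ∈ A) D, h.1, h.2,
      Finset.filter_union_filter_not_eq]
  let g : Finset α × Finset α → ℝ≥0∞ := fun x =>
    ({D | ↑D ⊆ A ∧ D ∈ E} : Set (Finset α)).indicator (fun D => ∏ f ∈ D, w f) x.1 *
      ({D | ↑D ⊆ Aᶜ ∧ D ∈ E'} : Set (Finset α)).indicator (fun D => ∏ f ∈ D, w f) x.2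
  have hg : Function.support g ⊆ Set.range e := by
    rintro ⟨D₁, D₂⟩ h
    have h1 : D₁ ∈ ({D | ↑D ⊆ A ∧ D ∈ E} : Set (Finset α)) := by
      by_contra h1
      exact h (by simp only [g, Set.indicator_of_notMem h1, zero_mul])
    have h2 : D₂ ∈ ({D | ↑D ⊆ Aᶜ ∧ D ∈ E'} : Set (Finset α)) := by
      by_contra h2
      exact h (by simp only [g, Set.indicator_of_notMem h2, mul_zero])
    refine ⟨D₁ ∪ D₂, Prod.ext ?_ ?_⟩
    · simp only [e, Finset.filter_union]
      rw [Finset.filter_true_of_mem fun x hx => h1.1 hx,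
        Finset.filter_false_of_mem fun x hx => h2.1 hx, Finset.union_empty]
    · simp only [e, Finset.filter_union]
      rw [Finset.filter_false_of_mem fun x hx => not_not.2 (h1.1 hx),
        Finset.filter_true_of_mem (p := (· ∉ A)) fun x hx => h2.1 hx, Finset.empty_union]
  rw [weight, weight, weight, ← ENNReal.tsum_mul_right]
  simp only [← ENNReal.tsum_mul_left]
  rw [← ENNReal.tsum_prod (f := fun a b => g (a, b)), ← he.tsum_eq hg]
  refine tsum_congr fun D => ?_
  have hA : ↑(D.filter (· ∈ A)) ⊆ A := fun x hx => (Finset.mem_filter.1 hx).2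
  have hA' : ↑(D.filter (· ∉ A)) ⊆ Aᶜ := fun x hx => (Finset.mem_filter.1 hx).2
  simp only [g, e, Set.indicator_apply, Set.mem_ofPred_eq, hA, hA', true_and]
  by_cases h1 : D.filter (· ∈ A) ∈ E <;> by_cases h2 : D.filter (· ∉ A) ∈ E' <;>
    simp [h1, h2, Finset.prod_filter_mul_prod_filter_not]

theorem one_le_weight (w : α → ℝ≥0∞) {E : Set (Finset α)} (hE : ∅ ∈ E) : 1 ≤ weight w E := by
  refine le_trans ?_ (ENNReal.le_tsum ∅)
  simp [hE]

theorem weight_mono (w : α → ℝ≥0∞) {E E' : Set (Finset α)} (h : E ⊆ E') :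
    weight w E ≤ weight w E' :=
  ENNReal.tsum_le_tsum fun _ => Set.indicator_le_indicator_of_subset h (fun _ => zero_le) _

theorem prod_one_add_le (w : α → ℝ≥0∞) (s : Finset α) (h : ∑ f ∈ s, w f ≤ 1 / 2) :
    ∏ f ∈ s, (1 + w f) ≤ 1 + 2 * ∑ f ∈ s, w f := by
  classical
  induction s using Finset.induction_on with
  | empty => simp
  | insert a s ha ih =>
    rw [Finset.sum_insert ha] at h ⊢
    rw [Finset.prod_insert ha]
    have hs : ∑ f ∈ s, w f ≤ 1 / 2 := le_add_self.trans h
    have h2 : 2 * ∑ f ∈ s, w f ≤ 1 := by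
      calc 2 * ∑ f ∈ s, w f ≤ 2 * (1 / 2) := by gcongr
        _ = 1 := by rw [one_div]; exact ENNReal.mul_inv_cancel (by simp) (by simp)
    calc (1 + w a) * ∏ f ∈ s, (1 + w f)
        ≤ (1 + w a) * (1 + 2 * ∑ f ∈ s, w f) := by gcongr; exact ih hs
      _ = 1 + 2 * ∑ f ∈ s, w f + (w a + w a * (2 * ∑ f ∈ s, w f)) := by ring
      _ ≤ 1 + 2 * ∑ f ∈ s, w f + (w a + w a * 1) := by gcongr
      _ = _ := by ring

/-- Finitely many sets lie in the powerset of their union, whose total weight is a finite product of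
the factors `1 + w f`. -/
theorem weight_univ_le_two (w : α → ℝ≥0∞) (h : ∑' f, w f ≤ 1 / 2) :
    weight w Set.univ ≤ 2 := by
  classical
  rw [weight, ENNReal.tsum_eq_iSup_sum]
  refine iSup_le fun 𝒮 => ?_
  have hs : ∑ f ∈ 𝒮.sup id, w f ≤ 1 / 2 := (ENNReal.sum_le_tsum _).trans h
  calc ∑ D ∈ 𝒮, Set.univ.indicator (fun D => ∏ f ∈ D, w f) D
      = ∑ D ∈ 𝒮, ∏ f ∈ D, w f := by simp
    _ ≤ ∑ D ∈ (𝒮.sup id).powerset, ∏ f ∈ D, w f :=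
        Finset.sum_le_sum_of_subset fun D hD =>
          Finset.mem_powerset.2 (Finset.le_sup (f := id) hD)
    _ = ∏ f ∈ 𝒮.sup id, (1 + w f) := (Finset.prod_one_add _).symm
    _ ≤ 1 + 2 * ∑ f ∈ 𝒮.sup id, w f := prod_one_add_le w _ hs
    _ ≤ 1 + 2 * (1 / 2) := by gcongr
    _ = 2 := by
      rw [one_div, ENNReal.mul_inv_cancel (by simp) (by simp)]
      norm_num

theorem weight_indicator (w : α → ℝ≥0∞) (A : Set α) :
    weight (A.indicator w) Set.univ = weight w {D | ↑D ⊆ A} := by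
  classical
  refine tsum_congr fun D => ?_
  rw [Set.indicator_univ, Set.indicator_apply]
  split_ifs with h
  · exact Finset.prod_congr rfl fun f hf => Set.indicator_of_mem (h hf) _
  · obtain ⟨f, hf, hfA⟩ := Set.not_subset.1 h
    exact Finset.prod_eq_zero hf (Set.indicator_of_notMem hfA _)

/-- The random set to which the elements `f` belong independently, with odds `w f`. -/
def weightPMF (w : α → ℝ≥0∞) (hw : weight w Set.univ ≠ ∞) : PMF (Finset α) :=
  PMF.normalize (Set.univ.indicator fun D => ∏ f ∈ D, w f)
    (zero_lt_one.trans_le (one_le_weight w (Set.mem_univ _))).ne' hw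

variable {w : α → ℝ≥0∞}

theorem weightPMF_apply (hw : weight w Set.univ ≠ ∞) (E : Set (Finset α)) :
    (weightPMF w hw).toOuterMeasure E = weight w E / weight w Set.univ := by
  rw [PMF.toOuterMeasure_apply, weight, div_eq_mul_inv, ← ENNReal.tsum_mul_right]
  refine tsum_congr fun D => ?_
  by_cases h : D ∈ E
  · simp [h, weightPMF, weight]
  · simp [h]

theorem ne_zero_of_one_le {x : ℝ≥0∞} (h : 1 ≤ x) : x ≠ 0 := (zero_lt_one.trans_le h).ne'

open scoped Classical in
theorem weightPMF_split (hw : weight w Set.univ ≠ ∞) (A : Set α) (E E' : Set (Finset α)) :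
    (weightPMF w hw).toOuterMeasure {D | D.filter (· ∈ A) ∈ E ∧ D.filter (· ∉ A) ∈ E'} =
      weight w {D | ↑D ⊆ A ∧ D ∈ E} / weight w {D | ↑D ⊆ A} *
        (weight w {D | ↑D ⊆ Aᶜ ∧ D ∈ E'} / weight w {D | ↑D ⊆ Aᶜ}) := by
  have huniv := weight_split w A Set.univ Set.univ
  simp only [Set.mem_univ, and_true, Set.ofPred_true] at huniv
  rw [weightPMF_apply, weight_split, huniv]
  refine ENNReal.mul_div_mul_comm (Or.inl ?_) (Or.inl ?_)
  · exact ne_zero_of_one_le (one_le_weight w (by simp))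
  · exact ne_top_of_le_ne_top hw (weight_mono w (Set.subset_univ _))

open scoped Classical in
theorem weightPMF_filter (hw : weight w Set.univ ≠ ∞) (A : Set α) (E : Set (Finset α)) :
    (weightPMF w hw).toOuterMeasure {D | D.filter (· ∈ A) ∈ E} =
      weight w {D | ↑D ⊆ A ∧ D ∈ E} / weight w {D | ↑D ⊆ A} := by
  have := weightPMF_split hw A E Set.univ
  simp only [Set.mem_univ, and_true] at this
  rw [this, ENNReal.div_self, mul_one]
  · exact ne_zero_of_one_le (one_le_weight w (by simp))
  · exact ne_top_of_le_ne_top hw (weight_mono w (Set.subset_univ _))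

open scoped Classical in
theorem weightPMF_indep (hw : weight w Set.univ ≠ ∞) (A : Set α) (E E' : Set (Finset α)) :
    (weightPMF w hw).toOuterMeasure {D | D.filter (· ∈ A) ∈ E ∧ D.filter (· ∉ A) ∈ E'} =
      (weightPMF w hw).toOuterMeasure {D | D.filter (· ∈ A) ∈ E} *
        (weightPMF w hw).toOuterMeasure {D | D.filter (· ∉ A) ∈ E'} := by
  rw [weightPMF_split, weightPMF_filter, ← weightPMF_filter hw Aᶜ E']
  simp only [Set.mem_compl_iff]

open scoped Classical in
theorem weightPMF_indep_blocks (hw : weight w Set.univ ≠ ∞) (c : α → κ) (K : Finset κ)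
    (E : κ → Set (Finset α)) :
    (weightPMF w hw).toOuterMeasure {D | ∀ k ∈ K, D.filter (c · = k) ∈ E k} =
      ∏ k ∈ K, (weightPMF w hw).toOuterMeasure {D | D.filter (c · = k) ∈ E k} := by
  induction K using Finset.induction_on with
  | empty => simp [pmf_univ]
  | insert k K hk ih =>
    have hsub : ∀ (D : Finset α), ∀ j ∈ K,
        (D.filter (¬ c · = k)).filter (c · = j) = D.filter (c · = j) := by
      intro D j hj
      rw [Finset.filter_filter]
      refine Finset.filter_congr fun f _ => ⟨And.right, fun h => ⟨?_, h⟩⟩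
      rintro rfl
      exact hk (h ▸ hj)
    have key := weightPMF_indep hw {f | c f = k} (E k)
      {D | ∀ j ∈ K, D.filter (c · = j) ∈ E j}
    have hset : ∀ D : Finset α, (∀ j ∈ K, (D.filter (¬ c · = k)).filter (c · = j) ∈ E j) ↔
        ∀ j ∈ K, D.filter (c · = j) ∈ E j := fun D =>
      forall₂_congr fun j hj => by rw [hsub D j hj]
    simp only [Set.mem_ofPred_eq, hset] at key
    rw [Finset.prod_insert hk, ← ih, ← key]
    simp only [Finset.forall_mem_insert]

theorem weightPMF_indepFacts (hw : weight w Set.univ ≠ ∞) : IndepFacts (weightPMF w hw) := by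
  classical
  intro F
  -- Each element is its own block here, and belongs to `D` exactly if its block is nonempty in `D`.
  have key := weightPMF_indep_blocks hw id F fun _ => {D | D.Nonempty}
  have h : ∀ (D : Finset α) f, (D.filter (id · = f)).Nonempty ↔ f ∈ D := by
    intro D f
    simp [Finset.Nonempty]
  simp only [Set.mem_ofPred_eq, h] at key
  exact key

open scoped Classical in
theorem weightPMF_filter_eq_singleton (hw : weight w Set.univ ≠ ∞) (c : α → κ) (f : α) :
    (weightPMF w hw).toOuterMeasure {D | D.filter (c · = c f) = {f}} =
      w f / weight w {D | ↑D ⊆ {g | c g = c f}} := by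
  have := weightPMF_filter hw {g | c g = c f} {{f}}
  simp only [Set.mem_ofPred_eq, Set.mem_singleton_iff] at this
  rw [this]
  congr 1
  rw [weight, tsum_eq_single {f}]
  · simp
  · intro D hD
    simp [hD]

/-- The elements of `D` that are alone in their block. -/
def isolated (lab : α → κ) (D : Finset α) : Finset α :=
  open scoped Classical in D.filter fun f => ∀ g ∈ D, lab g = lab f → g = f

theorem mem_isolated {lab : α → κ} {D : Finset α} {f : α} :
    f ∈ isolated lab D ↔ f ∈ D ∧ ∀ g ∈ D, lab g = lab f → g = f := by
  classical
  simp [isolated]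

theorem two_mul_le_half {x : ℝ≥0∞} (h : x ≤ 1 / 4) : 2 * x ≤ 1 / 2 := by
  calc 2 * x ≤ 2 * (1 / 4) := by gcongr
    _ = 1 / 2 := by
      rw [show (4 : ℝ≥0∞) = 2 * 2 by norm_num, one_div, one_div,
        ENNReal.mul_inv (by simp) (by simp), ← mul_assoc,
        ENNReal.mul_inv_cancel (by simp) (by simp), one_mul]

/-- Odds under which the isolated elements of a random set have given small probabilities. -/
theorem exists_odds (p : α → ℝ≥0∞) (hp : ∑' f, p f ≤ 1 / 4) (A : Set α) :
    ∃ t : ℝ≥0∞, t ≤ 2 ∧ weight (fun f => t * p f) {D | ↑D ⊆ A} = t := by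
  let F : ℝ≥0∞ →o ℝ≥0∞ :=
    { toFun := fun t => weight (fun f => t * p f) {D | ↑D ⊆ A}
      monotone' := fun t t' h => ENNReal.tsum_le_tsum fun D => by
        refine Set.indicator_le_indicator ?_
        exact Finset.prod_le_prod' fun f _ => mul_le_mul_left h _ }
  -- Knaster–Tarski replaces continuity: `F` is monotone and `F 2 ≤ 2`, because the odds `2 * p f`
  -- sum to at most 1/2.
  refine ⟨OrderHom.lfp F, OrderHom.lfp_le F ?_, OrderHom.map_lfp F⟩
  refine (weight_mono _ (Set.subset_univ _)).trans (weight_univ_le_two _ ?_)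
  rw [ENNReal.tsum_mul_left]
  exact two_mul_le_half hp

/-- With `t k` the total weight of block `k`, the fact `f` is isolated with probability `t k * p f /
t k = p f`. Independence of the blocks gives the inclusion probabilities of sets meeting each block
at most once; all others have probability zero on both sides. -/
theorem exists_indepFacts_isolated [Countable α] {lab : α → κ} {μ : PMF (Finset α)}
    (h : BlockIndep lab μ) (hp : ∑' f, marginal μ f ≤ 1 / 4) :
    ∃ ν : PMF (Finset α), IndepFacts ν ∧ ν.map (isolated lab) = μ := by
  classical
  choose t ht2 ht using fun k => exists_odds (marginal μ) hp {f | lab f = k}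
  let w : α → ℝ≥0∞ := fun f => t (lab f) * marginal μ f
  have hw : weight w Set.univ ≠ ∞ := by
    refine ne_top_of_le_ne_top (by simp) (weight_univ_le_two w ?_)
    refine le_trans ?_ (two_mul_le_half hp)
    rw [← ENNReal.tsum_mul_left]
    exact ENNReal.tsum_le_tsum fun f => mul_le_mul_left (ht2 _) _
  have hblock : ∀ k, weight w {D | ↑D ⊆ {g | lab g = k}} = t k := by
    intro k
    rw [← weight_indicator]
    conv_rhs => rw [← ht k, ← weight_indicator]
    congr 1
    refine Set.indicator_congr fun f hf => ?_
    simp only [w]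
    rw [show lab f = k from hf]
  have ht0 : ∀ k, t k ≠ 0 := fun k => by
    rw [← hblock k]
    exact ne_zero_of_one_le (one_le_weight w (by simp))
  have httop : ∀ k, t k ≠ ∞ := fun k => ne_top_of_le_ne_top (by simp) (ht2 k)
  have hfilter : ∀ (D : Finset α) f, f ∈ isolated lab D ↔ D.filter (lab · = lab f) = {f} := by
    intro D f
    rw [mem_isolated, Finset.eq_singleton_iff_unique_mem]
    simp
  refine ⟨weightPMF w hw, weightPMF_indepFacts hw, pmf_finset_ext fun F => ?_⟩
  rw [PMF.toOuterMeasure_map_apply]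
  by_cases hF : Set.InjOn lab F
  · have key := weightPMF_indep_blocks hw lab (F.image lab)
      -- Since `lab` is injective on `F`, this is one condition per block met by `F`.
      fun k => {D | ∀ f ∈ F, lab f = k → D = {f}}
    rw [Finset.prod_image hF] at key
    rw [h.prod F hF]
    convert key using 1
    · congr 1
      ext D
      simp only [Set.mem_preimage, Set.mem_ofPred_eq, Finset.subset_iff, hfilter,
        Finset.forall_mem_image]
      constructor
      · intro hD f hf g hg hgf
        rw [← hgf]
        exact hD hg
      · intro hD f hf
        exact hD hf f hf rfl
    · refine Finset.prod_congr rfl fun f hf => ?_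
      have : {D : Finset α | D.filter (lab · = lab f) ∈
          ({D | ∀ g ∈ F, lab g = lab f → D = {g}} : Set (Finset α))} =
          {D | D.filter (lab · = lab f) = {f}} := by
        ext D
        simp only [Set.mem_ofPred_eq]
        refine ⟨fun hD => hD f hf rfl, fun hD g hg hgf => ?_⟩
        rw [hF hg hf hgf]
        exact hD
      rw [this, weightPMF_filter_eq_singleton, hblock]
      exact (ENNReal.eq_div_iff (ht0 _) (httop _)).2 rfl
  · rw [h.eq_zero_of_not_injOn hF]
    have : isolated lab ⁻¹' {D | F ⊆ D} = ∅ := by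
      refine Set.eq_empty_of_forall_notMem fun D hD => hF fun f hf g hg hfg => ?_
      exact (mem_isolated.1 (hD hg)).2 f (mem_isolated.1 (hD hf)).1 hfg
    rw [this, MeasureTheory.measure_empty]

end ProbDB
end

noncomputable section

namespace ProbDB

variable {α β κ : Type*}

/-! ### Removing an element and restoring it with an independent coin -/

/-- The distribution of a coin showing `true` with probability `q`. -/
def coinPMF (q : ℝ≥0∞) (hq : q ≤ 1) : PMF Bool :=
  PMF.ofFintype (fun b => bif b then q else 1 - q) (by simp [add_tsub_cancel_of_le hq])

theorem pmf_bind_coin {γ : Type*} (ν : PMF β) {q : ℝ≥0∞} (hq : q ≤ 1) (g : β → Bool → γ)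
    (E : Set γ) :
    (ν.bind fun D => (coinPMF q hq).map (g D)).toOuterMeasure E =
      q * ν.toOuterMeasure {D | g D true ∈ E} +
        (1 - q) * ν.toOuterMeasure {D | g D false ∈ E} := by
  classical
  rw [PMF.toOuterMeasure_bind_apply, PMF.toOuterMeasure_apply, PMF.toOuterMeasure_apply,
    ← ENNReal.tsum_mul_left, ← ENNReal.tsum_mul_left, ← ENNReal.tsum_add]
  refine tsum_congr fun D => ?_
  rw [PMF.toOuterMeasure_map_apply, PMF.toOuterMeasure_apply_fintype, Fintype.sum_bool]
  simp only [Set.indicator_apply, Set.mem_preimage, coinPMF, PMF.ofFintype_apply, cond_true,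
    cond_false, Set.mem_ofPred_eq]
  split_ifs <;> ring

theorem add_coin_weights {q : ℝ≥0∞} (hq : q ≤ 1) (x : ℝ≥0∞) : q * x + (1 - q) * x = x := by
  rw [← add_mul, add_tsub_cancel_of_le hq, one_mul]

/-- The elements of `D` other than `s`. -/
def remove (s : α) (D : Finset α) : Finset α :=
  open scoped Classical in D.erase s

theorem mem_remove {s f : α} {D : Finset α} : f ∈ remove s D ↔ f ≠ s ∧ f ∈ D := by
  classical
  simp [remove]

/-- Adds `s` to `D` if the coin `c` shows `true` and no element of `D` is in the block of `s`. -/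
def restore (lab : α → κ) (s : α) (D : Finset α) (c : Bool) : Finset α :=
  open scoped Classical in if c = true ∧ ∀ f ∈ D, lab f ≠ lab s then insert s D else D

theorem mem_restore {lab : α → κ} {s f : α} {D : Finset α} {c : Bool} :
    f ∈ restore lab s D c ↔ f ∈ D ∨ f = s ∧ c = true ∧ ∀ g ∈ D, lab g ≠ lab s := by
  classical
  rw [restore]
  split_ifs with h
  · rw [Finset.mem_insert]
    tauto
  · tauto

theorem map_remove_subset (μ : PMF (Finset α)) {s : α} {F : Finset α} (hs : s ∉ F) :
    (μ.map (remove s)).toOuterMeasure {D | F ⊆ D} = μ.toOuterMeasure {D | F ⊆ D} := by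
  rw [PMF.toOuterMeasure_map_apply]
  congr 1
  ext D
  simp only [Set.mem_preimage, Set.mem_ofPred_eq, Finset.subset_iff, mem_remove]
  exact forall₂_congr fun f hf => ⟨And.right, fun h => ⟨fun h' => hs (h' ▸ hf), h⟩⟩

theorem map_remove_subset_of_mem (μ : PMF (Finset α)) {s : α} {F : Finset α} (hs : s ∈ F) :
    (μ.map (remove s)).toOuterMeasure {D | F ⊆ D} = 0 := by
  rw [PMF.toOuterMeasure_map_apply]
  have : remove s ⁻¹' {D | F ⊆ D} = ∅ :=
    Set.eq_empty_of_forall_notMem fun D hD => (mem_remove.1 (hD hs)).1 rfl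
  rw [this, MeasureTheory.measure_empty]

theorem marginal_eq_subset (μ : PMF (Finset α)) (f : α) :
    marginal μ f = μ.toOuterMeasure {D | {f} ⊆ D} := by
  simp [marginal]

theorem marginal_map_remove (μ : PMF (Finset α)) {s f : α} (hf : f ≠ s) :
    marginal (μ.map (remove s)) f = marginal μ f := by
  rw [marginal_eq_subset, marginal_eq_subset, map_remove_subset]
  simpa using hf.symm

theorem marginal_map_remove_self (μ : PMF (Finset α)) (s : α) :
    marginal (μ.map (remove s)) s = 0 := by
  rw [marginal_eq_subset, map_remove_subset_of_mem _ (by simp)]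

variable {lab : α → κ} {μ : PMF (Finset α)}

theorem BlockIndep.remove (h : BlockIndep lab μ) (s : α) :
    BlockIndep lab (μ.map (remove s)) where
  prod F hF := by
    by_cases hs : s ∈ F
    · rw [map_remove_subset_of_mem _ hs, Finset.prod_eq_zero hs (marginal_map_remove_self _ _)]
    · rw [map_remove_subset _ hs, h.prod F hF]
      refine Finset.prod_congr rfl fun f hf => (marginal_map_remove _ ?_).symm
      rintro rfl
      exact hs hf
  disj f f' hne hl := by
    rw [PMF.toOuterMeasure_map_apply]
    exact MeasureTheory.measure_mono_null
      (show _ ⊆ {D | f ∈ D ∧ f' ∈ D} from fun D hD =>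
        ⟨(mem_remove.1 hD.1).2, (mem_remove.1 hD.2).2⟩) (h.disj f f' hne hl)

/-- The event that the block of `s` contributes nothing but possibly `s`. -/
def othersAbsent (lab : α → κ) (s : α) : Set (Finset α) :=
  {D | ∀ f ∈ D, f ≠ s → lab f ≠ lab s}

/-- The block may be infinite, so its absence is handled through the complement: up to null sets, a
countable disjoint union of the events that one given other fact is present, each independent of `G
⊆ D`. -/
theorem BlockIndep.inter_othersAbsent [Countable α] (h : BlockIndep lab μ) {s : α} {G : Finset α}
    (hG : Set.InjOn lab G) (hs : ∀ f ∈ G, lab f ≠ lab s) :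
    μ.toOuterMeasure ({D | G ⊆ D} ∩ othersAbsent lab s) =
      μ.toOuterMeasure (othersAbsent lab s) * μ.toOuterMeasure {D | G ⊆ D} := by
  classical
  set y := ∑' f : {f // f ≠ s ∧ lab f = lab s}, marginal μ f with hy
  have key : ∀ G : Finset α, Set.InjOn lab G → (∀ f ∈ G, lab f ≠ lab s) →
      μ.toOuterMeasure ({D | G ⊆ D} \ othersAbsent lab s) = y * μ.toOuterMeasure {D | G ⊆ D} := by
    intro G hG hs
    have hU : {D | G ⊆ D} \ othersAbsent lab s =
        ⋃ f : {f // f ≠ s ∧ lab f = lab s}, {D | insert f.1 G ⊆ D} := by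
      ext D
      simp only [othersAbsent, Set.mem_sdiff, Set.mem_ofPred_eq, Set.mem_iUnion,
        Finset.insert_subset_iff, Subtype.exists, not_forall, not_not]
      constructor
      · rintro ⟨h1, f, h2, h3, h4⟩
        exact ⟨f, ⟨h3, h4⟩, h2, h1⟩
      · rintro ⟨f, ⟨h3, h4⟩, h2, h1⟩
        exact ⟨h1, f, h2, h3, h4⟩
    rw [hU, pmf_iUnion, hy, ← ENNReal.tsum_mul_right]
    · refine tsum_congr fun f => ?_
      have hf : f.1 ∉ G := fun hf => hs _ hf f.2.2
      have hinj : Set.InjOn lab ↑(insert f.1 G) := by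
        rw [Finset.coe_insert, Set.injOn_insert hf]
        refine ⟨hG, ?_⟩
        rintro ⟨g, hg, hgf⟩
        exact hs g hg (hgf.trans f.2.2)
      rw [h.prod _ hinj, h.prod _ hG, Finset.prod_insert hf]
    · intro f g hfg
      refine MeasureTheory.measure_mono_null
        (show _ ⊆ {D | f.1 ∈ D ∧ g.1 ∈ D} from fun D hD => ?_)
        (h.disj f.1 g.1 (fun h => hfg (Subtype.ext h)) (f.2.2.trans g.2.2.symm))
      exact ⟨hD.1 (Finset.mem_insert_self _ _), hD.2 (Finset.mem_insert_self _ _)⟩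
  -- The case `G = ∅` identifies `y` as the probability that some other fact of the block is
  -- present.
  have h1 := pmf_inter_add_diff μ {D | (∅ : Finset α) ⊆ D} (othersAbsent lab s)
  rw [key ∅ (by simp) (by simp)] at h1
  simp only [Finset.empty_subset, Set.ofPred_true, Set.univ_inter, pmf_univ, mul_one] at h1
  have h2 := pmf_inter_add_diff μ {D | G ⊆ D} (othersAbsent lab s)
  rw [key G hG hs] at h2
  have hy1 : y ≤ 1 := h1 ▸ le_add_self
  have hfin : y * μ.toOuterMeasure {D | G ⊆ D} ≠ ∞ :=
    ENNReal.mul_ne_top (ne_top_of_le_ne_top ENNReal.one_ne_top hy1) (pmf_ne_top _ _)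
  refine (ENNReal.add_left_inj hfin).1 ?_
  rw [h2, ← add_mul, h1, one_mul]

theorem BlockIndep.marginal_le_othersAbsent [Countable α] (h : BlockIndep lab μ) (s : α) :
    marginal μ s ≤ μ.toOuterMeasure (othersAbsent lab s) := by
  have h1 := pmf_inter_add_diff μ {D | s ∈ D} (othersAbsent lab s)
  have h2 : μ.toOuterMeasure ({D | s ∈ D} \ othersAbsent lab s) = 0 := by
    have hsub : {D | s ∈ D} \ othersAbsent lab s ⊆
        ⋃ f : {f // f ≠ s ∧ lab f = lab s}, {D | f.1 ∈ D ∧ s ∈ D} := by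
      intro D hD
      simp only [othersAbsent, Set.mem_sdiff, Set.mem_ofPred_eq, not_forall, not_not] at hD
      obtain ⟨h1, f, h2, h3, h4⟩ := hD
      exact Set.mem_iUnion.2 ⟨⟨f, h3, h4⟩, h2, h1⟩
    refine MeasureTheory.measure_mono_null hsub (MeasureTheory.measure_iUnion_null fun f => ?_)
    exact h.disj f.1 s f.2.1 f.2.2
  rw [h2, add_zero] at h1
  rw [marginal, ← h1]
  exact μ.toOuterMeasure.mono Set.inter_subset_right

/-- The bias is the conditional probability of `s` given that the rest of its block is absent. For
`F` containing `s`, the restored set includes `F` with probability `q * r` times that of `F.erase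
s`, and `q * r` is the marginal of `s`. -/
theorem BlockIndep.exists_coin [Countable α] (h : BlockIndep lab μ) (s : α) :
    ∃ (q : ℝ≥0∞) (hq : q ≤ 1),
      (μ.map (ProbDB.remove s)).bind (fun D => (coinPMF q hq).map (restore lab s D)) = μ := by
  classical
  set r := μ.toOuterMeasure (othersAbsent lab s) with hr
  have hle := h.marginal_le_othersAbsent s
  rw [← hr] at hle
  have hq : marginal μ s / r ≤ 1 := ENNReal.div_le_of_le_mul (by rwa [one_mul])
  have hqr : marginal μ s / r * r = marginal μ s := by
    -- If the rest of the block is almost surely present, then `s` has marginal zero and the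
    -- quotient does no harm.
    by_cases h0 : r = 0
    · rw [h0] at hle ⊢
      rw [mul_zero, nonpos_iff_eq_zero.1 hle]
    · exact ENNReal.div_mul_cancel h0 (pmf_ne_top _ _)
  refine ⟨_, hq, pmf_finset_ext fun F => ?_⟩
  rw [pmf_bind_coin]
  simp only [Set.mem_ofPred_eq]
  by_cases hs : s ∈ F
  · have hfalse : {D | F ⊆ restore lab s D false} = {D | F ⊆ D} := by
      simp [restore]
    rw [hfalse, map_remove_subset_of_mem _ hs, mul_zero, add_zero, PMF.toOuterMeasure_map_apply]
    have htrue : ProbDB.remove s ⁻¹' {D | F ⊆ restore lab s D true} =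
        {D | F.erase s ⊆ D} ∩ othersAbsent lab s := by
      ext D
      simp only [Set.mem_preimage, Set.mem_ofPred_eq, Finset.subset_iff, mem_restore, mem_remove,
        Set.mem_inter_iff, othersAbsent, Finset.mem_erase]
      constructor
      · intro hD
        refine ⟨fun f hf => ?_, fun f hf hfs => ?_⟩
        · rcases hD hf.2 with h' | h'
          · exact h'.2
          · exact absurd h'.1 hf.1
        · rcases hD hs with h' | h'
          · exact absurd rfl h'.1
          · exact h'.2.2 f ⟨hfs, hf⟩
      · rintro ⟨h1, h2⟩ f hf
        by_cases hfs : f = s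
        · exact Or.inr ⟨hfs, trivial, fun g hg => h2 g hg.2 hg.1⟩
        · exact Or.inl ⟨hfs, h1 ⟨hfs, hf⟩⟩
    rw [htrue]
    by_cases hF : Set.InjOn lab F
    · rw [h.inter_othersAbsent, ← mul_assoc, hqr, h.prod F hF, h.prod,
        Finset.mul_prod_erase _ _ hs]
      · exact hF.mono (Finset.erase_subset _ _)
      · exact hF.mono (Finset.erase_subset _ _)
      · intro f hf hl
        exact Finset.ne_of_mem_erase hf (hF (Finset.mem_of_mem_erase hf) hs hl)
    · rw [h.eq_zero_of_not_injOn hF]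
      -- Either the clash of labels involves `s`, which contradicts the absence of the others, or it
      -- lies within `F.erase s`, which is a null event.
      by_cases hF' : Set.InjOn lab ↑(F.erase s)
      · have : {D | F.erase s ⊆ D} ∩ othersAbsent lab s = ∅ := by
          refine Set.eq_empty_of_forall_notMem fun D hD => hF ?_
          rw [← Finset.insert_erase hs, Finset.coe_insert, Set.injOn_insert (by simp)]
          refine ⟨hF', ?_⟩
          rintro ⟨f, hf, hl⟩
          exact hD.2 f (hD.1 hf) (Finset.ne_of_mem_erase hf) hl
        rw [this, MeasureTheory.measure_empty, mul_zero]
      · rw [MeasureTheory.measure_mono_null Set.inter_subset_left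
          (h.eq_zero_of_not_injOn hF'), mul_zero]
  · have hset : ∀ c, {D | F ⊆ restore lab s D c} = {D | F ⊆ D} := by
      intro c
      ext D
      simp only [Set.mem_ofPred_eq, Finset.subset_iff, mem_restore]
      refine forall₂_congr fun f hf => ⟨fun h => ?_, Or.inl⟩
      rcases h with h | h
      · exact h
      · exact absurd (h.1 ▸ hf) hs
    rw [hset, hset, add_coin_weights hq, map_remove_subset _ hs]

end ProbDB
end

noncomputable section

namespace ProbDB

universe u

/-! ### Transport along injections, and definable equality of facts -/

theorem BlockIndep.map {α β κ : Type*} {lab : α → κ} {μ : PMF (Finset α)}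
    (h : BlockIndep lab μ) (e : α ↪ β) {lab' : β → κ} (hlab : ∀ f, lab' (e f) = lab f) :
    BlockIndep lab' (μ.map (Finset.map e)) := by
  classical
  have hsub : ∀ F : Finset α, (μ.map (Finset.map e)).toOuterMeasure {D | F.map e ⊆ D} =
      μ.toOuterMeasure {D | F ⊆ D} := by
    intro F
    rw [PMF.toOuterMeasure_map_apply]
    congr 1
    ext D
    simp
  have hmarg : ∀ f, marginal (μ.map (Finset.map e)) (e f) = marginal μ f := by
    intro f
    rw [marginal_eq_subset, marginal_eq_subset, ← hsub, Finset.map_singleton]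
  have hzero : ∀ g, g ∉ Set.range e →
      (μ.map (Finset.map e)).toOuterMeasure {D | g ∈ D} = 0 := by
    intro g hg
    rw [PMF.toOuterMeasure_map_apply]
    convert MeasureTheory.measure_empty (μ := μ.toOuterMeasure)
    refine Set.eq_empty_of_forall_notMem fun D hD => hg ?_
    obtain ⟨f, -, hf⟩ := Finset.mem_map.1 hD
    exact ⟨f, hf⟩
  constructor
  · intro F hF
    by_cases hr : ∀ g ∈ F, g ∈ Set.range e
    · obtain ⟨F, rfl⟩ : ∃ F' : Finset α, F = F'.map e := by
        refine ⟨F.preimage e e.injective.injOn, ?_⟩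
        rw [Finset.map_eq_image, Finset.image_preimage, Finset.filter_true_of_mem hr]
      rw [hsub, h.prod, Finset.prod_map]
      · simp only [hmarg]
      · intro f hf g hg hfg
        refine e.injective (hF (by simpa using hf) (by simpa using hg) ?_)
        rwa [hlab, hlab]
    · push Not at hr
      obtain ⟨g, hg, hge⟩ := hr
      rw [Finset.prod_eq_zero hg (hzero g hge)]
      exact MeasureTheory.measure_mono_null
        (show {D | F ⊆ D} ⊆ {D | g ∈ D} from fun D hD => hD hg) (hzero g hge)
  · intro g g' hne hl
    by_cases hg : g ∈ Set.range e
    · by_cases hg' : g' ∈ Set.range e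
      · obtain ⟨f, rfl⟩ := hg
        obtain ⟨f', rfl⟩ := hg'
        rw [hlab, hlab] at hl
        rw [PMF.toOuterMeasure_map_apply]
        refine MeasureTheory.measure_mono_null (show _ ⊆ {D | f ∈ D ∧ f' ∈ D} from ?_)
          (h.disj f f' (fun hf => hne (hf ▸ rfl)) hl)
        intro D hD
        simpa using hD
      · exact MeasureTheory.measure_mono_null
          (show {D | g ∈ D ∧ g' ∈ D} ⊆ {D | g' ∈ D} from fun D hD => hD.2) (hzero g' hg')
    · exact MeasureTheory.measure_mono_null
        (show {D | g ∈ D ∧ g' ∈ D} ⊆ {D | g ∈ D} from fun D hD => hD.1) (hzero g hg)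

variable {σ τ : Schema} {U : Type u}

theorem fact_eq_iff {R : τ.Rel} {v w : Fin (τ.arity R) → U} :
    (⟨R, v⟩ : Fact τ U) = ⟨R, w⟩ ↔ ∀ i, v i = w i := by
  rw [Sigma.mk.injEq, heq_eq_eq, funext_iff]
  simp

theorem DefinableQuery.eqFact (R S : τ.Rel) :
    DefinableQuery fun (_ : Instance σ U) (v : Fin (τ.arity R) ⊕ Fin (τ.arity S) → U) =>
      (⟨R, fun i => v (.inl i)⟩ : Fact τ U) = ⟨S, fun i => v (.inr i)⟩ := by
  by_cases h : R = S
  · subst h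
    simp only [fact_eq_iff]
    exact .forallFinite fun i => .eqVar (Sum.inl i) (Sum.inr i)
  · exact (DefinableQuery.const False).congr fun D v => by simp [h]

theorem DefinableQuery.eqFactConst (R : τ.Rel) (s : Fact τ U) :
    DefinableQuery fun (_ : Instance σ U) (v : Fin (τ.arity R) → U) =>
      (⟨R, v⟩ : Fact τ U) = s := by
  obtain ⟨S, w⟩ := s
  by_cases h : R = S
  · subst h
    simp only [fact_eq_iff]
    exact .forallFinite fun i => .eqConst i (w i)
  · exact (DefinableQuery.const False).congr fun D v => by simp [h]

/-! ### Schemas with block identifiers -/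

/-- The schema with one additional attribute, the block identifier, in every relation. -/
def labelled (τ : Schema) : Schema where
  Rel := τ.Rel
  finite_rel := τ.finite_rel
  nonempty_rel := τ.nonempty_rel
  arity R := τ.arity R + 1

/-- The block identifier of a fact. -/
def blockId (f : Fact (labelled τ) U) : U := f.2 (0 : Fin (τ.arity f.1 + 1))

/-- Removes the block identifier of a fact. -/
def dropLabel (f : Fact (labelled τ) U) : Fact τ U :=
  ⟨f.1, fun i : Fin (τ.arity f.1) => f.2 (i.succ : Fin (τ.arity f.1 + 1))⟩

/-- Adds block identifiers to facts. -/
def addLabel (b : Fact τ U → U) : Fact τ U ↪ Fact (labelled τ) U where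
  toFun f := ⟨f.1, (Fin.cons (b f) f.2 : Fin (τ.arity f.1 + 1) → U)⟩
  inj' := Function.LeftInverse.injective (g := dropLabel) fun _ => rfl

/-- Removes the block identifiers in an instance. -/
def dropLabels (D : Instance (labelled τ) U) : Instance τ U :=
  open scoped Classical in D.image dropLabel

theorem dropLabels_map_addLabel (b : Fact τ U → U) (D : Instance τ U) :
    dropLabels (D.map (addLabel b)) = D := by
  classical
  ext f
  simp only [dropLabels, Finset.mem_image, Finset.mem_map, exists_exists_and_eq_and]
  exact ⟨fun ⟨_, hg, h⟩ => h ▸ hg, fun h => ⟨f, h, rfl⟩⟩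

theorem definableMap_dropLabels :
    DefinableMap (dropLabels : Instance (labelled τ) U → Instance τ U) where
  mem R := by
    have h := DefinableMap.id.existsFact (σ := labelled τ) (U := U)
      (P := fun f _ (v : Fin (τ.arity R) → U) => dropLabel f = ⟨R, v⟩)
      fun S => (DefinableQuery.eqFact (τ := τ) S R).comp (Sum.map Fin.succ id)
    exact h.congr fun D v => by simp [dropLabels]
  bound := by
    refine ⟨∅, Set.finite_empty, fun D a => ?_⟩
    rintro ⟨f, hf, i, rfl⟩
    simp only [dropLabels, Finset.mem_image] at hf
    obtain ⟨g, hg, rfl⟩ := hf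
    exact Or.inl ⟨g, hg, (Fin.succ i : Fin (τ.arity g.1 + 1)), rfl⟩

/-- This is what the identifiers are for: lying in the same block becomes equality of two
attributes, whatever the original partition was. -/
theorem definableMap_isolated :
    DefinableMap (isolated blockId : Instance (labelled τ) U → Instance (labelled τ) U) where
  mem R := by
    have h := DefinableMap.id.existsFact (σ := labelled τ) (U := U)
      (P := fun g _ (v : Fin ((labelled τ).arity R) → U) =>
        blockId g = v (0 : Fin (τ.arity R + 1)) ∧ ¬ g = ⟨R, v⟩)
      fun S => (DefinableQuery.eqVar (Sum.inl (0 : Fin (τ.arity S + 1)))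
        (Sum.inr (0 : Fin (τ.arity R + 1)))).and (DefinableQuery.eqFact S R).not
    refine ((DefinableQuery.mem R id).and h.not).congr fun D v => ?_
    rw [mem_isolated]
    refine and_congr Iff.rfl ?_
    simp only [id, not_exists, not_and, not_not]
    rfl
  bound := by
    refine ⟨∅, Set.finite_empty, fun D a => ?_⟩
    rintro ⟨f, hf, i, rfl⟩
    exact Or.inl ⟨f, (mem_isolated.1 hf).1, i, rfl⟩

/-! ### Adding an independent coin to an instance -/

/-- The schema with an additional nullary relation symbol. -/
def withCoin (σ : Schema) : Schema where
  Rel := Option σ.Rel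
  finite_rel := inferInstance
  nonempty_rel := inferInstance
  arity o := o.elim 0 σ.arity

/-- The nullary fact. -/
def coinFact : Fact (withCoin σ) U := ⟨none, Fin.elim0⟩

/-- The facts of the old schema as facts of the extended one. -/
def liftFact : Fact σ U ↪ Fact (withCoin σ) U where
  toFun f := ⟨some f.1, f.2⟩
  inj' := by
    rintro ⟨R, v⟩ ⟨S, w⟩ h
    change (⟨some R, v⟩ : Fact (withCoin σ) U) = ⟨some S, w⟩ at h
    injection h with h1 h2
    injection h1 with h1
    subst h1
    exact congrArg _ (eq_of_heq h2)

theorem liftFact_ne_coinFact (f : Fact σ U) : liftFact f ≠ coinFact := by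
  intro h
  have := congrArg Sigma.fst h
  exact absurd this (by simp [liftFact, coinFact])

theorem eq_coinFact_or_liftFact (f : Fact (withCoin σ) U) :
    f = coinFact ∨ ∃ g, f = liftFact g := by
  obtain ⟨R | R, v⟩ := f
  · left
    refine congrArg (Sigma.mk none) (funext fun i => ?_)
    exact Fin.elim0 i
  · exact Or.inr ⟨⟨R, v⟩, rfl⟩

/-- Adds the coin to an instance. -/
def attach (D : Instance σ U) (c : Bool) : Instance (withCoin σ) U :=
  open scoped Classical in if c = true then insert coinFact (D.map liftFact) else D.map liftFact

/-- Removes the coin from an instance. -/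
def strip (D : Instance (withCoin σ) U) : Instance σ U :=
  D.preimage liftFact liftFact.injective.injOn

theorem mem_strip {D : Instance (withCoin σ) U} {f : Fact σ U} :
    f ∈ strip D ↔ liftFact f ∈ D := by
  simp [strip]

theorem liftFact_mem_attach {D : Instance σ U} {c : Bool} {f : Fact σ U} :
    liftFact f ∈ attach D c ↔ f ∈ D := by
  classical
  rw [attach]
  split_ifs <;> simp [liftFact_ne_coinFact]

theorem coinFact_mem_attach {D : Instance σ U} {c : Bool} :
    coinFact ∈ attach D c ↔ c = true := by
  classical
  rw [attach]
  split_ifs with h <;> simp [h, liftFact_ne_coinFact]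

theorem attach_subset_iff {D : Instance σ U} {c : Bool} {I : Instance (withCoin σ) U} :
    attach D c ⊆ I ↔ D ⊆ strip I ∧ (c = true → coinFact ∈ I) := by
  constructor
  · exact fun h => ⟨fun f hf => mem_strip.2 (h (liftFact_mem_attach.2 hf)),
      fun hc => h (coinFact_mem_attach.2 hc)⟩
  · rintro ⟨h1, h2⟩ f hf
    rcases eq_coinFact_or_liftFact f with rfl | ⟨g, rfl⟩
    · exact h2 (coinFact_mem_attach.1 hf)
    · exact mem_strip.1 (h1 (liftFact_mem_attach.1 hf))

theorem strip_attach (D : Instance σ U) (c : Bool) : strip (attach D c) = D := by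
  ext f
  rw [mem_strip, liftFact_mem_attach]

theorem exists_eq_attach (I : Instance (withCoin σ) U) : ∃ D c, I = attach D c := by
  classical
  refine ⟨strip I, decide (coinFact ∈ I), ?_⟩
  ext f
  rcases eq_coinFact_or_liftFact f with rfl | ⟨g, rfl⟩
  · simp [coinFact_mem_attach]
  · rw [liftFact_mem_attach, mem_strip]

theorem definableMap_strip :
    DefinableMap (strip : Instance (withCoin σ) U → Instance σ U) where
  mem R := (DefinableQuery.mem (σ := withCoin σ) (some R) id).congr fun _ _ => by
    rw [mem_strip]
    rfl
  bound := by
    refine ⟨∅, Set.finite_empty, fun D a => ?_⟩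
    rintro ⟨f, hf, i, rfl⟩
    exact Or.inl ⟨liftFact f, mem_strip.1 hf, i, rfl⟩

/-- Adds an independent coin to a random instance. -/
def attachCoin (ν : PMF (Instance σ U)) (q : ℝ≥0∞) (hq : q ≤ 1) : PMF (Instance (withCoin σ) U) :=
  ν.bind fun D => (coinPMF q hq).map (attach D)

theorem attachCoin_subset (ν : PMF (Instance σ U)) {q : ℝ≥0∞} (hq : q ≤ 1) (F : Instance σ U)
    (c : Bool) : (attachCoin ν q hq).toOuterMeasure {I | attach F c ⊆ I} =
      (if c = true then q else 1) * ν.toOuterMeasure {D | F ⊆ D} := by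
  rw [attachCoin, pmf_bind_coin]
  simp only [Set.mem_ofPred_eq, attach_subset_iff, strip_attach, coinFact_mem_attach]
  cases c
  · simp [add_coin_weights hq]
  · simp

/-- Every finite set of facts of the extended schema has the form `attach F c`, and its inclusion
probability is that of `F` times the factor of the coin. -/
theorem IndepFacts.attachCoin {ν : PMF (Instance σ U)} (h : IndepFacts ν) {q : ℝ≥0∞}
    (hq : q ≤ 1) : IndepFacts (attachCoin ν q hq) := by
  classical
  have hlift : ∀ f, marginal (ProbDB.attachCoin ν q hq) (liftFact f) = marginal ν f := by
    intro f
    have := attachCoin_subset ν hq {f} false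
    simpa [marginal_eq_subset, attach] using this
  have hcoin : marginal (ProbDB.attachCoin ν q hq) coinFact = q := by
    have := attachCoin_subset ν hq ∅ true
    simpa [marginal_eq_subset, attach, pmf_univ] using this
  intro I
  obtain ⟨F, c, rfl⟩ := exists_eq_attach I
  rw [attachCoin_subset, h F]
  cases c
  · simp [attach, hlift]
  · simp only [attach, if_true]
    rw [Finset.prod_insert (by simp [liftFact_ne_coinFact]), hcoin]
    simp [hlift]

/-! ### Representable distributions -/

/-- A distribution on instances is representable if it is a definable image of a distribution with
independent facts. -/
def Representable (μ : PMF (Instance τ U)) : Prop :=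
  ∃ (σ : Schema) (ν : PMF (Instance σ U)) (T : Instance σ U → Instance τ U),
    IndepFacts ν ∧ DefinableMap T ∧ ν.map T = μ

theorem Representable.map {ρ : Schema} {μ : PMF (Instance τ U)} (h : Representable μ)
    {S : Instance τ U → Instance ρ U} (hS : DefinableMap S) : Representable (μ.map S) := by
  obtain ⟨σ, ν, T, hν, hT, rfl⟩ := h
  exact ⟨σ, ν, fun D => S (T D), hν, hS.comp hT, (PMF.map_comp T ν S).symm⟩

theorem definableMap_restore (s : Fact (labelled τ) U)
    {T : Instance σ U → Instance (labelled τ) U} (hT : DefinableMap T) :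
    DefinableMap fun I : Instance (withCoin σ) U =>
      open scoped Classical in restore blockId s (T (strip I)) (decide (coinFact ∈ I)) where
  mem R := by
    have hT' := hT.comp definableMap_strip
    have hcoin : DefinableQuery fun (I : Instance (withCoin σ) U)
        (_ : Fin ((labelled τ).arity R) → U) => coinFact ∈ I :=
      (DefinableQuery.mem (σ := withCoin σ) none Fin.elim0).congr fun I v =>
        iff_of_eq <| congrArg (· ∈ I) <| congrArg (Sigma.mk none) <|
          funext fun i => Fin.elim0 i
    have hblock := hT'.existsFact
      (P := fun g _ (_ : Fin ((labelled τ).arity R) → U) => blockId g = blockId s)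
      fun S => DefinableQuery.eqConst (Sum.inl (0 : Fin (τ.arity S + 1))) (blockId s)
    refine ((hT'.mem R).or ((DefinableQuery.eqFactConst R s).and
      (hcoin.and hblock.not))).congr fun I v => ?_
    rw [mem_restore]
    simp only [not_exists, not_and, ne_eq, decide_eq_true_eq]
  bound := by
    obtain ⟨C, hC, hb⟩ := (hT.comp definableMap_strip).bound
    refine ⟨C ∪ Set.range s.2, hC.union (Set.finite_range _), fun I a => ?_⟩
    rintro ⟨f, hf, i, rfl⟩
    rcases mem_restore.1 hf with hf | ⟨rfl, -⟩
    · exact (hb I ⟨f, hf, i, rfl⟩).imp id Or.inl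
    · exact Or.inr (Or.inr ⟨i, rfl⟩)

theorem Representable.restore {μ : PMF (Instance (labelled τ) U)} (h : Representable μ)
    (s : Fact (labelled τ) U) {q : ℝ≥0∞} (hq : q ≤ 1) :
    Representable (μ.bind fun D => (coinPMF q hq).map (restore blockId s D)) := by
  classical
  obtain ⟨σ, ν, T, hν, hT, rfl⟩ := h
  refine ⟨withCoin σ, attachCoin ν q hq, _, hν.attachCoin hq, definableMap_restore s hT, ?_⟩
  rw [attachCoin, PMF.map_bind, PMF.bind_map]
  congr 1
  funext D
  rw [PMF.map_comp]
  simp only [Function.comp_def, strip_attach, coinFact_mem_attach, Bool.decide_eq_true]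

/-- Induction on the exceptional set: deleting `s` makes its marginal zero and keeps the others, so
`s` may leave `S`; a coin then restores it. -/
theorem BlockIndep.representable_of_small [Countable U] (S : Finset (Fact (labelled τ) U))
    {μ : PMF (Instance (labelled τ) U)} (h : BlockIndep blockId μ)
    (hS : ∑' f, {f | f ∉ S}.indicator (marginal μ) f ≤ 1 / 4) : Representable μ := by
  classical
  induction S using Finset.induction_on generalizing μ with
  | empty =>
    obtain ⟨ν, hν, rfl⟩ := exists_indepFacts_isolated h (by simpa using hS)
    exact ⟨_, ν, _, hν, definableMap_isolated, rfl⟩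
  | insert s S hs ih =>
    obtain ⟨q, hq, hμ⟩ := h.exists_coin s
    rw [← hμ]
    refine (ih (h.remove s) (le_trans ?_ hS)).restore s hq
    refine ENNReal.tsum_le_tsum fun f => ?_
    by_cases hf : f = s
    · subst hf
      simp [marginal_map_remove_self]
    · by_cases hfS : f ∈ S <;> simp [hf, hfS, marginal_map_remove]

theorem BlockIndep.representable [Countable U] {b : Fact τ U → U} {μ : PMF (Instance τ U)}
    (h : BlockIndep b μ) : Representable μ := by
  have h' : BlockIndep blockId (μ.map (Finset.map (addLabel b))) := h.map _ fun _ => rfl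
  -- Tails of a convergent series vanish, which supplies the finite exceptional set.
  have hlim := ENNReal.tendsto_tsum_compl_atTop_zero h'.tsum_marginal_ne_top
  obtain ⟨S, hS⟩ := (hlim.eventually_le_const (u := 1 / 4) (by simp)).exists
  have := (h'.representable_of_small S ((tsum_subtype {f | f ∉ S} _).symm.trans_le hS)).map definableMap_dropLabels
  rw [PMF.map_comp] at this
  convert this
  conv_lhs => rw [← PMF.map_id μ]
  congr 1
  funext D
  exact (dropLabels_map_addLabel b D).symm

end ProbDB
end

/-! ### From probabilistic databases to distributions and back -/

noncomputable section

namespace ProbDB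

universe u

variable {τ : Schema} {U : Type u}

namespace PDB

theorem isImage_map {σ : Schema} {V : FOView σ τ U} {𝓘 : PDB σ U} {𝓓 : PDB τ U}
    (h : IsImage V 𝓘 𝓓) : 𝓘.dist.map V.apply = 𝓓.dist := by
  ext D
  rw [h.2 D, prob, ← PMF.toOuterMeasure_apply_singleton, PMF.toOuterMeasure_map_apply]
  rfl

theorem isTupleIndependent_of_indepFacts {𝓘 : PDB τ U} (h : IndepFacts 𝓘.dist) :
    𝓘.IsTupleIndependent := by
  classical
  intro k f hf _
  have := h (Finset.univ.image f)
  rw [Finset.prod_image hf.injOn] at this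
  simpa [Finset.subset_iff, prob, marginal] using this

theorem marginal_eq_zero {𝓘 : PDB τ U} {f : Fact τ U} (hf : f ∉ 𝓘.facts) :
    marginal 𝓘.dist f = 0 := by
  rw [marginal, PMF.toOuterMeasure_apply_eq_zero_iff, Set.disjoint_left]
  exact fun D hD hfD => hf ⟨D, (PMF.apply_pos_iff _ _).2 hD, hfD⟩

theorem exists_blockIndep [Countable U] [Infinite U] {𝓘 : PDB τ U}
    (h : 𝓘.IsBlockIndependentDisjoint) : ∃ b : Fact τ U → U, BlockIndep b 𝓘.dist := by
  classical
  obtain ⟨𝓑, ⟨-, hdisj, hcover⟩, hprod, hexcl⟩ := h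
  -- A total substitute for the block of `f`: the singleton of its block if `f` is a fact of the
  -- PDB, and empty otherwise. The facts of the second kind share a label, harmlessly, as they have
  -- probability zero. Countability of the facts lets these values be coded in `U`.
  let c : Fact τ U → Set (Set (Fact τ U)) := fun f => {B | B ∈ 𝓑 ∧ f ∈ B}
  have : Countable (Set.range c) := (Set.countable_range c).to_subtype
  obtain ⟨e⟩ : Nonempty (Set.range c ↪ U) := by
    obtain ⟨g, hg⟩ := exists_injective_nat (Set.range c)
    exact ⟨(⟨g, hg⟩ : Set.range c ↪ ℕ).trans (Infinite.natEmbedding U)⟩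
  let b : Fact τ U → U := fun f => e ⟨c f, f, rfl⟩
  have hb : ∀ {f g}, b f = b g ↔ c f = c g := fun {f g} => by
    exact e.injective.eq_iff.trans Subtype.ext_iff
  have hblock : ∀ f ∈ 𝓘.facts, ∃ B ∈ 𝓑, f ∈ B := fun f hf => by
    rw [← hcover] at hf
    exact hf
  refine ⟨b, fun F hF => ?_, fun f f' hne hl => ?_⟩
  · by_cases hfacts : ∀ f ∈ F, f ∈ 𝓘.facts
    · choose! B hB hfB using hblock
      have huniq : ∀ f ∈ F, ∀ g ∈ F, B f = B g → f = g := by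
        intro f hf g hg hfg
        refine hF hf hg (hb.2 ?_)
        have hc : ∀ f ∈ F, c f = {B f} := by
          intro f hf
          ext B'
          simp only [c, Set.mem_ofPred_eq, Set.mem_singleton_iff]
          constructor
          · rintro ⟨hB', hfB'⟩
            exact hdisj.elim_set hB' (hB f (hfacts f hf)) f hfB' (hfB f (hfacts f hf))
          · rintro rfl
            exact ⟨hB f (hfacts f hf), hfB f (hfacts f hf)⟩
        rw [hc f hf, hc g hg, hfg]
      let x : Fin F.card → Fact τ U := fun i => F.equivFin.symm i
      have hx : ∀ i, x i ∈ F := fun i => (F.equivFin.symm i).2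
      have key := hprod F.card (fun i => B (x i)) x
        (fun i j hij => F.equivFin.symm.injective (Subtype.ext (huniq _ (hx i) _ (hx j) hij)))
        (fun i => hB _ (hfacts _ (hx i))) (fun i => hfB _ (hfacts _ (hx i)))
      have hset : {I : Instance τ U | ∀ i, x i ∈ I} = {I | F ⊆ I} := by
        ext I
        refine ⟨fun hI f hf => ?_, fun hI i => hI (hx i)⟩
        have := hI (F.equivFin ⟨f, hf⟩)
        simpa [x] using this
      rw [hset] at key
      refine key.trans ?_
      rw [← Finset.prod_coe_sort F]
      exact F.equivFin.symm.prod_comp fun f => marginal 𝓘.dist f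
    · push Not at hfacts
      obtain ⟨f, hf, hff⟩ := hfacts
      rw [Finset.prod_eq_zero hf (marginal_eq_zero hff)]
      exact MeasureTheory.measure_mono_null
        (show {D | F ⊆ D} ⊆ {D | f ∈ D} from fun D hD => hD hf) (marginal_eq_zero hff)
  · by_cases hf : f ∈ 𝓘.facts
    · obtain ⟨B, hB, hfB⟩ := hblock f hf
      have hmem : B ∈ c f' := hb.1 hl ▸ (⟨hB, hfB⟩ : B ∈ c f)
      exact hexcl B hB f hfB f' hmem.2 hne
    · exact MeasureTheory.measure_mono_null
        (show {D | f ∈ D ∧ f' ∈ D} ⊆ {D | f ∈ D} from fun D hD => hD.1) (marginal_eq_zero hf)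

/-- Take singleton blocks. -/
theorem isBlockIndependentDisjoint_of_isTupleIndependent {𝓘 : PDB τ U}
    (h : 𝓘.IsTupleIndependent) : 𝓘.IsBlockIndependentDisjoint := by
  refine ⟨(fun f => {f}) '' 𝓘.facts, ⟨?_, ?_, ?_⟩, ?_, ?_⟩
  · rintro ⟨f, -, hf⟩
    exact Set.singleton_ne_empty f hf
  · rintro _ ⟨f, -, rfl⟩ _ ⟨g, -, rfl⟩ hne
    refine Set.disjoint_singleton.2 fun hfg => hne ?_
    simp only [hfg]
  · simp [Set.sUnion_image]
  · intro k B f hB hmem hf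
    have hBf : ∀ i, f i ∈ 𝓘.facts ∧ B i = {f i} := by
      intro i
      obtain ⟨g, hg, hgB⟩ := hmem i
      have hfi := hf i
      rw [← hgB] at hfi ⊢
      rw [Set.mem_singleton_iff.1 hfi]
      exact ⟨hg, rfl⟩
    refine h k f (fun i j hij => hB ?_) fun i => (hBf i).1
    rw [(hBf i).2, (hBf j).2, hij]
  · rintro _ ⟨g, -, rfl⟩ f hf f' hf' hne
    exact absurd ((Set.mem_singleton_iff.1 hf).trans (Set.mem_singleton_iff.1 hf').symm) hne

end PDB

theorem mem_FO_TI_of_representable {𝓓 : PDB τ U} (h : Representable 𝓓.dist) :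
    (⟨τ, 𝓓⟩ : Σ τ : Schema, PDB τ U) ∈ FO (TI U) := by
  obtain ⟨σ, ν, T, hν, hT, hmap⟩ := h
  obtain ⟨V, hV⟩ := hT.exists_view
  -- The sample space must be cut down to the support, since the view has to map all of it into the
  -- sample space of `𝓓`.
  refine ⟨⟨σ, ν.support, ν, subset_rfl⟩, PDB.isTupleIndependent_of_indepFacts hν, V, ?_, ?_⟩
  · intro I hI
    refine 𝓓.support_subset ?_
    rw [← hmap, PMF.support_map, hV]
    exact Set.mem_image_of_mem _ hI
  · intro D
    simp only [hV]
    rw [← hmap, ← PMF.toOuterMeasure_apply_singleton, PMF.toOuterMeasure_map_apply]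
    rfl

theorem TI_subset_BID : TI U ⊆ BID U := fun _ h =>
  PDB.isBlockIndependentDisjoint_of_isTupleIndependent h

theorem representable_of_mem_BID [Countable U] [Infinite U] {𝓑 : Σ τ : Schema, PDB τ U}
    (h : 𝓑 ∈ BID U) : Representable 𝓑.2.dist := by
  obtain ⟨b, hb⟩ := PDB.exists_blockIndep h
  exact hb.representable

end ProbDB
end

theorem mainTheorem3 (U : Type*) [Countable U] [Infinite U] :
    ProbDB.BID U ⊆ ProbDB.FO (ProbDB.TI U) ∧
      ProbDB.FO (ProbDB.BID U) = ProbDB.FO (ProbDB.TI U) := by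
  refine ⟨fun 𝓑 h => ProbDB.mem_FO_TI_of_representable (ProbDB.representable_of_mem_BID h),
    Set.Subset.antisymm ?_ ?_⟩
  · rintro ⟨τ, 𝓓⟩ ⟨𝓑, h𝓑, V, hV⟩
    refine ProbDB.mem_FO_TI_of_representable ?_
    rw [← ProbDB.PDB.isImage_map hV]
    -- The given view is itself a definable map, so it composes with the representation of `𝓑`.
    exact (ProbDB.representable_of_mem_BID h𝓑).map (ProbDB.DefinableMap.id.apply_comp V)
  · rintro 𝓓 ⟨𝓘, h𝓘, V, hV⟩
    exact ⟨𝓘, ProbDB.TI_subset_BID h𝓘, V, hV⟩
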